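/- Let $\Lambda$ be a finite index set. For each $i\in\Lambda$ fix integers $n_i>m_i\ge 2$, divide $[0,1]^2$ into a uniform $m_i\times n_i$ grid (rectangles of width $1/m_i$ and height $1/n_i$), and let $\mathcal I_i$ be a non-empty subset of the rectangles of this grid. For a rectangle $j\in\mathcal I_i$ let $S_j$ be the orientation preserving affine map $(x,y)\mapsto\left(\frac{a+x}{m_i},\frac{b+y}{n_i}\right)$ with integers $a,b$ that maps $[0,1]^2$ onto $j$. For $\omega=(\omega_1,\omega_2,\dots)\in\Omega=\Lambda^{\mathbb N}$ let \[ F_\omega=\bigcap_{k\ge1}\ \bigcup_{j_1\in\mathcal I_{\omega_1},\dots,j_k\in\mathcal I_{\omega_k}} S_{j_1}\circ\dots\circ S_{j_k}\left([0,1]^2\right). \] Let $(p_i)_{i\in\Lambda}$ satisfy $p_i>0$ and $\sum_i p_i=1$, and let $\mathbb P$ be the product measure on $\Omega$ with marginals $\sum_i p_i\delta_i$. For a bounded set $E\subseteq\mathbb R^2$ and $r>0$ let $N(E,r)$ be the least number of sets of diameter at most $r$ needed to cover $E$. For a non-empty compact set $F\subseteq\mathbb R^2$ and $\theta\in(0,1)$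 let \[ \overline{\dim}_{\mathrm B}F=\inf\left\{\alpha : (\exists C)(\forall\, 0<r<1)\ N(F,r)\le C\,(1/r)^\alpha\right\}, \] \[ \dim_{\mathrm A}^\theta F=\inf\left\{\alpha : (\exists C>0)(\forall\, 0<R<1)(\forall x\in F)\ N\left(B(x,R)\cap F,R^{1/\theta}\right)\le C\left(\frac{R}{R^{1/\theta}}\right)^\alpha\right\}, \] \[ \dim_{\mathrm{qA}}F=\lim_{\theta\to1^-}\inf\left\{\alpha : (\exists C>0)(\forall\, 0<r\le R^{1/\theta}\le R<1)(\forall x\in F)\ N\left(B(x,R)\cap F,r\right)\le C\left(\frac{R}{r}\right)^\alpha\right\}, \] where $B(x,R)$ is the closed ball. Then for $\mathbb P$-almost every $\omega\in\Omega$ the limit defining $\dim_{\mathrm{qA}}F_\omega$ exists and, for all $\theta\in(0,1)$, \[ \dim_{\mathrm A}^\theta F_\omega=\min\left\{\frac{\overline{\dim}_{\mathrm B}F_\omega-\theta\left(\dim_{\mathrm{qA}}F_\omega-\left(\dim_{\mathrm{qA}}F_\omega-\overline{\dim}_{\mathrm B}F_\omega\right)\dfrac{\sum_i p_i\log n_i}{\sum_i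 p_i\log m_i}\right)}{1-\theta},\ \dim_{\mathrm{qA}}F_\omega\right\}. \] -/

import Mathlib

open Set Filter Topology MeasureTheory

noncomputable section

namespace RandomCarpet

/-! ### Dimensions of a (non-empty, bounded) set -/

/-- `coverNum E r` is the least number of sets of diameter at most `r` needed to cover the bounded
set `E`, for a scale `r > 0`. -/
def coverNum {X : Type*} [PseudoEMetricSpace X] (E : Set X) (r : ℝ) : ℕ :=
  sInf {k : ℕ | ∃ U : Fin k → Set X,
    (∀ i, Metric.ediam (U i) ≤ ENNReal.ofReal r) ∧ E ⊆ ⋃ i, U i}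

/-- The upper box dimension of `F`. -/
def upperBoxDim {X : Type*} [PseudoMetricSpace X] (F : Set X) : ℝ :=
  sInf {α : ℝ | ∃ C : ℝ, ∀ r : ℝ, 0 < r → r < 1 →
    (coverNum F r : ℝ) ≤ C * (1 / r) ^ α}

/-- The Assouad spectrum of `F` at `θ`. -/
def assouadSpectrum {X : Type*} [PseudoMetricSpace X] (F : Set X) (θ : ℝ) : ℝ :=
  sInf {α : ℝ | ∃ C : ℝ, 0 < C ∧ ∀ R : ℝ, 0 < R → R < 1 → ∀ x ∈ F,
    (coverNum (Metric.closedBall x R ∩ F) (R ^ (1 / θ)) : ℝ) ≤ C * (R / R ^ (1 / θ)) ^ α}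

/-- The quantity whose limit as `θ → 1` is the quasi-Assouad dimension: here all scales
`r ≤ R ^ (1 / θ)` are considered. -/
def upperAssouadSpectrum {X : Type*} [PseudoMetricSpace X] (F : Set X) (θ : ℝ) : ℝ :=
  sInf {α : ℝ | ∃ C : ℝ, 0 < C ∧ ∀ r R : ℝ, 0 < r → r ≤ R ^ (1 / θ) → R ^ (1 / θ) ≤ R →
    0 < R → R < 1 → ∀ x ∈ F,
      (coverNum (Metric.closedBall x R ∩ F) r : ℝ) ≤ C * (R / r) ^ α}

/-- The quasi-Assouad dimension of `F`. -/
def quasiAssouadDim {X : Type*} [PseudoMetricSpace X] (F : Set X) : ℝ :=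
  limUnder (𝓝[<] (1 : ℝ)) (upperAssouadSpectrum F)

/-! ### Random Bedford-McMullen carpets -/

/-- A family of Bedford-McMullen patterns: for each letter `i`, the unit square is divided into a
grid with `m i` columns and `n i` rows, where `n i > m i ≥ 2`, and a non-empty set `rects i` of
rectangles of this grid is selected. The pair `(a, b)` is the rectangle in column `a`, row `b`. -/
structure Patterns (Λ : Type*) where
  m : Λ → ℕ
  n : Λ → ℕ
  two_le_m : ∀ i, 2 ≤ m i
  m_lt_n : ∀ i, m i < n i
  rects : (i : Λ) → Finset (Fin (m i) × Fin (n i))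
  rects_nonempty : ∀ i, (rects i).Nonempty

/-- The unit square `[0,1]²` in the Euclidean plane. -/
def unitSquare : Set (EuclideanSpace ℝ (Fin 2)) :=
  {z | ∀ t, z t ∈ Icc (0 : ℝ) 1}

namespace Patterns

variable {Λ : Type*} (S : Patterns Λ)

/-- The orientation preserving affine map taking the unit square onto the rectangle
`[a/m, (a+1)/m] × [b/n, (b+1)/n]`, where `j = (a, b)`. -/
def rectMap (i : Λ) (j : Fin (S.m i) × Fin (S.n i)) (z : EuclideanSpace ℝ (Fin 2)) :
    EuclideanSpace ℝ (Fin 2) :=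
  !₂[((j.1 : ℕ) + z 0) / (S.m i : ℝ), ((j.2 : ℕ) + z 1) / (S.n i : ℝ)]

/-- The composition of the maps of the first `k` rectangles of the sequence `j`, the first one
outermost. -/
def cylMap (ω : ℕ → Λ) (j : (l : ℕ) → Fin (S.m (ω l)) × Fin (S.n (ω l))) :
    ℕ → EuclideanSpace ℝ (Fin 2) → EuclideanSpace ℝ (Fin 2)
  | 0 => id
  | k + 1 => cylMap ω j k ∘ S.rectMap (ω k) (j k)

/-- The attractor associated with `ω` (with letters `ω 0, ω 1, …`): the intersection over `k ≥ 1`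
of the unions of the `k`-th level images of the unit square. -/
def carpet (ω : ℕ → Λ) : Set (EuclideanSpace ℝ (Fin 2)) :=
  ⋂ k : ℕ, ⋂ _ : 1 ≤ k, {z | ∃ j : (l : ℕ) → Fin (S.m (ω l)) × Fin (S.n (ω l)),
    (∀ l < k, j l ∈ S.rects (ω l)) ∧ z ∈ S.cylMap ω j k '' unitSquare}

end Patterns

/-- The measure `∑ᵢ pᵢ δᵢ` on the set of letters. -/
def letterMeasure {Λ : Type*} [Fintype Λ] [MeasurableSpace Λ] (p : Λ → ℝ) : Measure Λ :=
  ∑ i, ENNReal.ofReal (p i) • Measure.dirac i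

/-- The Bernoulli measure on `Λ^ℕ` with weights `p`: the infinite product of `∑ᵢ pᵢ δᵢ`. -/
def bernoulli {Λ : Type*} [Fintype Λ] [MeasurableSpace Λ] (p : Λ → ℝ) : Measure (ℕ → Λ) :=
  Measure.infinitePi fun _ : ℕ => letterMeasure p

/-- For probability weights `p`, the measure on letters is a probability measure, so that the
infinite product is the genuine one. -/
theorem isProbabilityMeasure_letterMeasure {Λ : Type*} [Fintype Λ] [MeasurableSpace Λ]
    (p : Λ → ℝ) (hp : ∀ i, 0 ≤ p i) (hsum : ∑ i, p i = 1) :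
    IsProbabilityMeasure (letterMeasure p) := by
  constructor
  simp [letterMeasure, ← ENNReal.ofReal_sum_of_nonneg (fun i _ => hp i), hsum]

end RandomCarpet

end

/-! At scale `r` the carpet is cut into approximate squares: column digits are fixed up to the level
k₁(r) where the product of the m's reaches about 1/r, row digits up to the smaller level k₂(r) where
the product of the n's does. Inside a square of side R, the number of squares of side r is bounded
by a product over levels. A level below k₂(R) contributes 1. Between k₂(R) and k₁(R) the column is
already fixed, and a level contributes at most its largest column if it is below k₂(r), and 1
otherwise. From k₁(R) on, a level contributes all digits if below k₂(r), and the number of columns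
otherwise. Following a fullest column at every level attains the product, called `count R r`. Up to
constant factors it is the largest covering number of a ball (`Codes.coverNum_le`,
`Codes.exists_le_coverNum`).

By the strong law of large numbers, almost surely the averages of log m, log n and the logarithms of
the largest column, the digit number and the column number converge, to a, b, γ, η, β
(`ae_hasAverages`). Then k₁(r) ~ log(1/r)/a and k₂(r) ~ log(1/r)/b, so every dimension becomes an
explicit limit. The box dimension is B = η/b + β/a - β/b. For r = R^{1/θ} the form of the limit
depends on whether k₂(r) is below or above k₁(R), that is, on the sign of θ - a/b. For θ ≥ a/b the
value is A = γ/b + β/a, independent of θ. The bound |D| ≤ (largest column)(column number) shows that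
A bounds the exponents at all smaller scales too, so A is the quasi-Assouad dimension. For θ < a/b
the limit is the first term of the minimum, and since A - B = (γ + β - η)/b ≥ 0 the two terms cross
exactly at θ = a/b (`spectrum_formula`). -/

noncomputable section

namespace RandomCarpet

/-! ### Mixed radix expansions -/

/-- The product of the first `k` bases. -/
def base (m : ℕ → ℕ) (k : ℕ) : ℕ := ∏ i ∈ Finset.range k, m i

/-- The integer with digits `a 0, …, a (k - 1)`, most significant first, in the mixed radix `m`. -/
def digitVal (m a : ℕ → ℕ) : ℕ → ℕ
  | 0 => 0
  | k + 1 => digitVal m a k * m k + a k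

/-- The reals in `[0, 1]` with an expansion starting with `a 0, …, a (k - 1)`. -/
def digitInterval (m a : ℕ → ℕ) (k : ℕ) : Set ℝ :=
  Icc (digitVal m a k / base m k) ((digitVal m a k + 1) / base m k)

theorem base_succ (m : ℕ → ℕ) (k : ℕ) : base m (k + 1) = base m k * m k :=
  Finset.prod_range_succ _ _

theorem base_pos {m : ℕ → ℕ} (hm : ∀ l, 2 ≤ m l) (k : ℕ) : 0 < base m k :=
  Finset.prod_pos fun i _ => by have := hm i; omega

theorem two_pow_le_base {m : ℕ → ℕ} (hm : ∀ l, 2 ≤ m l) (k : ℕ) : 2 ^ k ≤ base m k := by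
  simpa [base] using Finset.prod_le_prod' (s := Finset.range k) (f := fun _ => 2) fun i _ => hm i

theorem base_mono {m : ℕ → ℕ} (hm : ∀ l, 2 ≤ m l) : Monotone (base m) :=
  monotone_nat_of_le_succ fun k => by
    rw [base_succ]; exact Nat.le_mul_of_pos_right _ (by have := hm k; omega)

theorem digitVal_congr (m : ℕ → ℕ) {a a' : ℕ → ℕ} {k : ℕ} (h : ∀ l < k, a l = a' l) :
    digitVal m a k = digitVal m a' k := by
  induction k with
  | zero => rfl
  | succ k ih => simp only [digitVal]; rw [ih fun l hl => h l (by omega), h k (by omega)]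

theorem digitInterval_congr (m : ℕ → ℕ) {a a' : ℕ → ℕ} {k : ℕ} (h : ∀ l < k, a l = a' l) :
    digitInterval m a k = digitInterval m a' k := by
  simp only [digitInterval, digitVal_congr m h]

theorem digit_eq_of_digitVal_eq {m a a' : ℕ → ℕ} {k : ℕ} (ha : ∀ l < k, a l < m l)
    (ha' : ∀ l < k, a' l < m l) (h : digitVal m a k = digitVal m a' k) :
    ∀ l < k, a l = a' l := by
  induction k with
  | zero => intro l hl; omega
  | succ k ih =>
    simp only [digitVal] at h
    have h1 := ha k (by omega)
    have h2 := ha' k (by omega)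
    have hmod := congrArg (· % m k) h
    have hdiv := congrArg (· / m k) h
    have hpos : 0 < m k := by omega
    simp only [Nat.mul_add_mod_self_right, Nat.mod_eq_of_lt h1, Nat.mod_eq_of_lt h2] at hmod
    rw [Nat.mul_comm _ (m k), Nat.mul_comm _ (m k)] at hdiv
    simp only [Nat.mul_add_div hpos, Nat.div_eq_of_lt h1, Nat.div_eq_of_lt h2, add_zero] at hdiv
    intro l hl
    rcases Nat.lt_succ_iff_lt_or_eq.1 hl with hl | rfl
    · exact ih (fun l hl => ha l (by omega)) (fun l hl => ha' l (by omega)) hdiv l hl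
    · exact hmod

theorem digitInterval_succ_subset {m a : ℕ → ℕ} (hm : ∀ l, 2 ≤ m l) {k : ℕ} (ha : a k < m k) :
    digitInterval m a (k + 1) ⊆ digitInterval m a k := by
  have hb : (0 : ℝ) < base m k := by exact_mod_cast base_pos hm k
  have hk : (0 : ℝ) < m k := by have := hm k; exact_mod_cast (by omega : 0 < m k)
  have ha' : (a k : ℝ) + 1 ≤ m k := by exact_mod_cast ha
  have ha0 : (0 : ℝ) ≤ a k := Nat.cast_nonneg _
  apply Icc_subset_Icc
  · simp only [digitVal, base_succ]
    push_cast
    rw [div_le_div_iff₀ hb (by positivity)]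
    nlinarith [mul_nonneg hb.le ha0]
  · simp only [digitVal, base_succ]
    push_cast
    rw [div_le_div_iff₀ (by positivity) hb]
    nlinarith [mul_nonneg hb.le (sub_nonneg.2 ha')]

theorem digitInterval_subset {m a : ℕ → ℕ} (hm : ∀ l, 2 ≤ m l) {K k : ℕ} (hK : K ≤ k)
    (ha : ∀ l < k, a l < m l) : digitInterval m a k ⊆ digitInterval m a K := by
  induction k, hK using Nat.le_induction with
  | base => exact subset_rfl
  | succ k _ ih =>
    exact (digitInterval_succ_subset hm (ha k (by omega))).trans (ih fun l hl => ha l (by omega))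

theorem digitInterval_zero (m a : ℕ → ℕ) : digitInterval m a 0 = Icc 0 1 := by
  simp [digitInterval, digitVal, base]

theorem abs_sub_le_of_mem_digitInterval {m a : ℕ → ℕ} {k : ℕ} {x y : ℝ}
    (hx : x ∈ digitInterval m a k) (hy : y ∈ digitInterval m a k) :
    |x - y| ≤ 1 / base m k := by
  obtain ⟨h1, h2⟩ := hx
  obtain ⟨h3, h4⟩ := hy
  rw [add_div] at h2 h4
  rw [abs_le]
  constructor <;> linarith

/-- Close points lie in intervals with close integer labels. -/
theorem digitVal_le_of_abs_sub_le {m a a' : ℕ → ℕ} (hm : ∀ l, 2 ≤ m l) {k : ℕ} {x y d : ℝ}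
    {q : ℕ} (hx : x ∈ digitInterval m a k) (hy : y ∈ digitInterval m a' k) (hd : |x - y| ≤ d)
    (hq : d * base m k ≤ q) : digitVal m a k ≤ digitVal m a' k + (q + 1) := by
  have hb : (0 : ℝ) < base m k := by exact_mod_cast base_pos hm k
  have h1 := hx.1
  have h2 := hy.2
  rw [div_le_iff₀ hb] at h1
  rw [le_div_iff₀ hb] at h2
  have h3 : x - y ≤ d := (le_abs_self _).trans hd
  have h4 := mul_le_mul_of_nonneg_right h3 hb.le
  have : (digitVal m a k : ℝ) ≤ digitVal m a' k + (q + 1) := by linarith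
  exact_mod_cast this

/-! ### Passing from scales to levels -/

/-- The first level at which the product of the bases reaches `t`. -/
def levelOf (m : ℕ → ℕ) (t : ℝ) : ℕ := sInf {k : ℕ | t ≤ base m k}

theorem le_base_levelOf {m : ℕ → ℕ} (hm : ∀ l, 2 ≤ m l) (t : ℝ) : t ≤ base m (levelOf m t) := by
  refine Nat.sInf_mem (s := {k : ℕ | t ≤ base m k}) ?_
  obtain ⟨k, hk⟩ := pow_unbounded_of_one_lt t (one_lt_two : (1 : ℝ) < 2)
  exact ⟨k, hk.le.trans (by exact_mod_cast two_pow_le_base hm k)⟩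

theorem levelOf_le {m : ℕ → ℕ} {t : ℝ} {k : ℕ} (h : t ≤ base m k) : levelOf m t ≤ k :=
  Nat.sInf_le h

theorem levelOf_mono {m : ℕ → ℕ} (hm : ∀ l, 2 ≤ m l) : Monotone (levelOf m) := fun _ t h =>
  levelOf_le (h.trans (le_base_levelOf hm t))

theorem levelOf_one (m : ℕ → ℕ) : levelOf m 1 = 0 :=
  Nat.le_zero.1 (levelOf_le (by simp [base]))

/-- By minimality the preceding level is still below `t`, and one further factor is at most `H`.
With `le_base_levelOf` this pins the base at the chosen level to `t` up to a constant. -/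
theorem base_levelOf_le {m : ℕ → ℕ} {H : ℕ} (hm : ∀ l, 2 ≤ m l) (hH : ∀ l, m l ≤ H) {t : ℝ}
    (ht : 1 ≤ t) : (base m (levelOf m t) : ℝ) ≤ t * H := by
  have hH1 : (1 : ℝ) ≤ H := by exact_mod_cast (by have := hm 0; have := hH 0; omega : 1 ≤ H)
  rcases hk : levelOf m t with _ | k
  · simp only [base, Finset.range_zero, Finset.prod_empty, Nat.cast_one]
    nlinarith
  · have h : (base m k : ℝ) < t := by
      by_contra! h
      have := levelOf_le h
      omega
    rw [base_succ]
    push_cast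
    exact mul_le_mul h.le (by exact_mod_cast hH k) (by positivity) (by linarith)

theorem levelOf_le_levelOf {m n : ℕ → ℕ} (hm : ∀ l, 2 ≤ m l) (hmn : ∀ l, m l ≤ n l) (t : ℝ) :
    levelOf n t ≤ levelOf m t := by
  refine levelOf_le ((le_base_levelOf hm t).trans ?_)
  exact_mod_cast Finset.prod_le_prod' fun i _ => hmn i

/-! ### Covering numbers -/

/-- An infimum of naturals over an empty set would be 0; one finite cover rules this out and makes
the infimum attained. The lower bounds need the attained cover. -/
theorem coverNum_le_card {X ι : Type*} [PseudoEMetricSpace X] {E : Set X} {r : ℝ} (s : Finset ι)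
    (U : ι → Set X) (hU : ∀ i ∈ s, Metric.ediam (U i) ≤ ENNReal.ofReal r)
    (hE : E ⊆ ⋃ i ∈ s, U i) :
    coverNum E r ≤ s.card ∧ ∃ V : Fin (coverNum E r) → Set X,
      (∀ i, Metric.ediam (V i) ≤ ENNReal.ofReal r) ∧ E ⊆ ⋃ i, V i := by
  have h : s.card ∈ {k : ℕ | ∃ U : Fin k → Set X,
      (∀ i, Metric.ediam (U i) ≤ ENNReal.ofReal r) ∧ E ⊆ ⋃ i, U i} := by
    refine ⟨fun i => U (s.equivFin.symm i), fun i => hU _ (s.equivFin.symm i).2, fun z hz => ?_⟩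
    obtain ⟨i, hi, hzi⟩ := mem_iUnion₂.1 (hE hz)
    exact mem_iUnion.2 ⟨s.equivFin ⟨i, hi⟩, by simpa using hzi⟩
  exact ⟨Nat.sInf_le h, Nat.sInf_mem ⟨_, h⟩⟩

theorem card_le_sq_of_close (s : Finset (ℕ × ℕ)) (q : ℕ)
    (h : ∀ x ∈ s, ∀ y ∈ s, x.1 ≤ y.1 + q ∧ x.2 ≤ y.2 + q) : s.card ≤ (q + 1) ^ 2 := by
  rcases s.eq_empty_or_nonempty with rfl | hs
  · simp
  · obtain ⟨x, hx, hx'⟩ := s.exists_min_image Prod.fst hs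
    obtain ⟨y, hy, hy'⟩ := s.exists_min_image Prod.snd hs
    calc s.card ≤ (Finset.Icc x.1 (x.1 + q) ×ˢ Finset.Icc y.2 (y.2 + q)).card := by
          refine Finset.card_le_card fun z hz => ?_
          simp only [Finset.mem_product, Finset.mem_Icc]
          exact ⟨⟨hx' z hz, (h z hz x hx).1⟩, hy' z hz, (h z hz y hy).2⟩
      _ = (q + 1) ^ 2 := by
          simp only [Finset.card_product, Nat.card_Icc]
          rw [sq]; congr 1 <;> omega

/-! ### Sequences of digit sets -/

/-- A sequence of non-empty digit sets `D l ⊆ {0, …, m l - 1} × {0, …, n l - 1}` with bounded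
bases `2 ≤ m l < n l`. -/
structure DigitSeq where
  m : ℕ → ℕ
  n : ℕ → ℕ
  D : ℕ → Finset (ℕ × ℕ)
  H : ℕ
  two_le_m : ∀ l, 2 ≤ m l
  m_lt_n : ∀ l, m l < n l
  n_le : ∀ l, n l ≤ H
  fst_lt : ∀ l, ∀ d ∈ D l, d.1 < m l
  snd_lt : ∀ l, ∀ d ∈ D l, d.2 < n l
  nonempty : ∀ l, (D l).Nonempty

/-- The number of columns met by a set of digits. -/
def colNum (D : Finset (ℕ × ℕ)) : ℕ := (D.image Prod.fst).card

/-- The largest number of digits in one column. -/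
def colMax (D : Finset (ℕ × ℕ)) : ℕ :=
  (D.image Prod.fst).sup fun c => (D.filter fun d => d.1 = c).card

theorem card_column_le_colMax (D : Finset (ℕ × ℕ)) (c : ℕ) :
    (D.filter fun d => d.1 = c).card ≤ colMax D := by
  by_cases hc : c ∈ D.image Prod.fst
  · exact Finset.le_sup (f := fun c => (D.filter fun d => d.1 = c).card) hc
  · rw [Finset.filter_false_of_mem]
    · simp
    · rintro d hd rfl
      exact hc (Finset.mem_image_of_mem _ hd)

theorem exists_card_column_eq_colMax {D : Finset (ℕ × ℕ)} (hD : D.Nonempty) :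
    ∃ d ∈ D, (D.filter fun d' => d'.1 = d.1).card = colMax D := by
  obtain ⟨c, hc, h⟩ := Finset.exists_mem_eq_sup (D.image Prod.fst) (hD.image _)
    fun c => (D.filter fun d => d.1 = c).card
  obtain ⟨d, hd, rfl⟩ := Finset.mem_image.1 hc
  exact ⟨d, hd, h.symm⟩

/-- After averaging logarithms this becomes η ≤ γ + β, the source of every comparison between the
box and quasi-Assouad dimensions. -/
theorem card_le_colNum_mul_colMax (D : Finset (ℕ × ℕ)) : D.card ≤ colMax D * colNum D :=
  Finset.card_le_mul_card_image D _ fun c _ => card_column_le_colMax D c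

theorem colNum_pos {D : Finset (ℕ × ℕ)} (hD : D.Nonempty) : 0 < colNum D :=
  Finset.card_pos.2 (hD.image _)

theorem colMax_pos {D : Finset (ℕ × ℕ)} (hD : D.Nonempty) : 0 < colMax D := by
  obtain ⟨d, hd, h⟩ := exists_card_column_eq_colMax hD
  rw [← h]
  exact Finset.card_pos.2 ⟨d, by simp [hd]⟩

namespace DigitSeq

variable (T : DigitSeq)

theorem two_le_n (l : ℕ) : 2 ≤ T.n l := (T.two_le_m l).trans (T.m_lt_n l).le

theorem m_le (l : ℕ) : T.m l ≤ T.H := (T.m_lt_n l).le.trans (T.n_le l)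

/-- The number of choices at level `l` of an approximate square with `k₁` columns and `k₂` rows
specified inside one with `K₁` columns and `K₂` rows specified. -/
def choices (K₁ K₂ k₂ l : ℕ) : ℕ :=
  if l < K₂ then 1 else if l < K₁ then (if l < k₂ then colMax (T.D l) else 1)
  else if l < k₂ then (T.D l).card else colNum (T.D l)

/-- The part of a digit at level `l` which is visible if `k₂` rows are specified. -/
def visible (k₂ l : ℕ) (d : ℕ × ℕ) : ℕ × ℕ := (d.1, if l < k₂ then d.2 else 0)

/-- The digits up to level `k₁` of an approximate square. -/
def label (k₁ k₂ : ℕ) (j : ℕ → ℕ × ℕ) (l : Fin k₁) : ℕ × ℕ := visible k₂ l (j l)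

/-- Extension of a finite sequence by a given infinite one. -/
def extend {k : ℕ} (d : ℕ → ℕ × ℕ) (t : Fin k → ℕ × ℕ) (l : ℕ) : ℕ × ℕ :=
  if h : l < k then t ⟨l, h⟩ else d l

theorem card_image_visible_le {K₁ K₂ k₂ l : ℕ} (hK : K₂ ≤ K₁) (c : ℕ × ℕ) :
    (((T.D l).filter fun d => (l < K₁ → d.1 = c.1) ∧ (l < K₂ → d.2 = c.2)).image
      (visible k₂ l)).card ≤ T.choices K₁ K₂ k₂ l := by
  unfold choices
  split_ifs with h1 h2 h3 h3
  · refine Finset.card_le_one.2 fun x hx y hy => ?_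
    simp only [Finset.mem_image, Finset.mem_filter] at hx hy
    obtain ⟨x, ⟨-, hx1, hx2⟩, rfl⟩ := hx
    obtain ⟨y, ⟨-, hy1, hy2⟩, rfl⟩ := hy
    simp [visible, hx1 (by omega), hx2 h1, hy1 (by omega), hy2 h1]
  · refine Finset.card_image_le.trans (le_trans ?_ (card_column_le_colMax (T.D l) c.1))
    exact Finset.card_le_card fun d hd => by
      simp only [Finset.mem_filter] at hd ⊢
      exact ⟨hd.1, hd.2.1 h2⟩
  · refine Finset.card_le_one.2 fun x hx y hy => ?_
    simp only [Finset.mem_image, Finset.mem_filter] at hx hy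
    obtain ⟨x, ⟨-, hx1, hx2⟩, rfl⟩ := hx
    obtain ⟨y, ⟨-, hy1, hy2⟩, rfl⟩ := hy
    simp [visible, hx1 h2, hy1 h2, h3]
  · exact Finset.card_image_le.trans (Finset.card_filter_le _ _)
  · refine le_trans (Finset.card_le_card fun x hx => ?_)
      (Finset.card_image_le (s := (T.D l).image Prod.fst) (f := fun a => (a, 0)))
    simp only [Finset.mem_image, Finset.mem_filter] at hx ⊢
    obtain ⟨x, ⟨hx, -⟩, rfl⟩ := hx
    exact ⟨x.1, ⟨x, hx, rfl⟩, by simp [visible, h3]⟩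

/-- The upper bound on choices is attained when the prescribed digit lies in a fullest column. -/
theorem choices_le_card_image_visible {K₁ K₂ k₂ l : ℕ} {c : ℕ × ℕ} (hc : c ∈ T.D l)
    (hc' : ((T.D l).filter fun d => d.1 = c.1).card = colMax (T.D l)) :
    T.choices K₁ K₂ k₂ l ≤ (((T.D l).filter fun d =>
      (l < K₁ → d.1 = c.1) ∧ (l < K₂ → d.2 = c.2)).image (visible k₂ l)).card := by
  have hone : 1 ≤ (((T.D l).filter fun d =>
      (l < K₁ → d.1 = c.1) ∧ (l < K₂ → d.2 = c.2)).image (visible k₂ l)).card :=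
    Finset.card_pos.2 (Finset.Nonempty.image ⟨c, by simp [hc]⟩ _)
  have hinj : l < k₂ → Function.Injective (visible k₂ l) := fun h x y hxy => by
    simp only [visible, h, if_true, Prod.mk.injEq] at hxy
    exact Prod.ext hxy.1 hxy.2
  unfold choices
  split_ifs with h1 h2 h3 h3
  · exact hone
  · rw [Finset.card_image_of_injective _ (hinj h3), ← hc']
    exact Finset.card_le_card fun d hd => by
      simp only [Finset.mem_filter] at hd ⊢
      exact ⟨hd.1, fun _ => hd.2, fun h => absurd h h1⟩
  · exact hone
  · rw [Finset.card_image_of_injective _ (hinj h3)]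
    exact Finset.card_le_card fun d hd => by
      simp only [Finset.mem_filter]
      exact ⟨hd, fun h => absurd h h2, fun h => absurd h h1⟩
  · rw [colNum, ← Finset.card_image_of_injective (f := fun a : ℕ => (a, 0)) _
      fun a b h => (Prod.mk.inj h).1]
    refine Finset.card_le_card fun x hx => ?_
    simp only [Finset.mem_image, Finset.mem_filter] at hx ⊢
    obtain ⟨a, ⟨d, hd, rfl⟩, rfl⟩ := hx
    exact ⟨d, ⟨hd, fun h => absurd h h2, fun h => absurd h h1⟩, by simp [visible, h3]⟩

/-- The number of labels of a family of codes is bounded by the number of labels at the coarser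
scale times the number of choices. -/
theorem card_label_le {K₁ K₂ k₁ k₂ c : ℕ} (hK : K₂ ≤ K₁) (hk₂ : K₂ ≤ k₂) (hk₁ : K₁ ≤ k₁)
    (hk : k₂ ≤ k₁) (L : Finset (Fin k₁ → ℕ × ℕ))
    (hL : ∀ t ∈ L, ∃ j : ℕ → ℕ × ℕ, (∀ l < k₁, j l ∈ T.D l) ∧ label k₁ k₂ j = t)
    (hc : ((L.image fun t => (digitVal T.m (fun l => (extend 0 t l).1) K₁,
      digitVal T.n (fun l => (extend 0 t l).2) K₂)).card ≤ c)) :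
    L.card ≤ (∏ l ∈ Finset.range k₁, T.choices K₁ K₂ k₂ l) * c := by
  -- Labels are grouped by the pair of integers naming their coarse approximate square: there are at
  -- most `c` groups, and each is bounded level by level by `card_image_visible_le`.
  refine (Finset.card_le_mul_card_image L _ ?_).trans (Nat.mul_le_mul_left _ hc)
  intro b hb
  obtain ⟨t₀, ht₀, rfl⟩ := Finset.mem_image.1 hb
  rw [← Fin.prod_univ_eq_prod_range]
  refine le_trans (Finset.card_le_card fun t ht => ?_) (le_trans
    (Fintype.card_piFinset fun l : Fin k₁ => (((T.D l).filter fun d =>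
      ((l : ℕ) < K₁ → d.1 = (t₀ l).1) ∧ ((l : ℕ) < K₂ → d.2 = (t₀ l).2)).image
        (visible k₂ l))).le
    (Finset.prod_le_prod' fun l _ => T.card_image_visible_le hK _))
  simp only [Finset.mem_filter, Prod.mk.injEq] at ht
  obtain ⟨ht, h1, h2⟩ := ht
  obtain ⟨j, hj, rfl⟩ := hL t ht
  obtain ⟨j₀, hj₀, rfl⟩ := hL t₀ ht₀
  have e1 : ∀ i : ℕ → ℕ × ℕ, ∀ l < k₁, (extend 0 (label k₁ k₂ i) l).1 = (i l).1 :=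
    fun i l hl => by simp [extend, hl, label, visible]
  have e2 : ∀ i : ℕ → ℕ × ℕ, ∀ l < k₂, (extend 0 (label k₁ k₂ i) l).2 = (i l).2 :=
    fun i l hl => by simp [extend, hl.trans_le hk, label, visible, hl]
  have h1' := digit_eq_of_digitVal_eq
    (fun l hl => by rw [e1 _ _ (by omega)]; exact T.fst_lt _ _ (hj _ (by omega)))
    (fun l hl => by rw [e1 _ _ (by omega)]; exact T.fst_lt _ _ (hj₀ _ (by omega))) h1
  have h2' := digit_eq_of_digitVal_eq
    (fun l hl => by rw [e2 _ _ (by omega)]; exact T.snd_lt _ _ (hj _ (by omega)))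
    (fun l hl => by rw [e2 _ _ (by omega)]; exact T.snd_lt _ _ (hj₀ _ (by omega))) h2
  simp only [Fintype.mem_piFinset, Finset.mem_image, Finset.mem_filter]
  intro l
  refine ⟨j l, ⟨hj _ l.2, fun hl => ?_, fun hl => ?_⟩, rfl⟩
  · have := h1' l hl
    rwa [e1 _ _ l.2, e1 _ _ l.2] at this
  · have := h2' l hl
    rw [e2 _ _ (by omega), e2 _ _ (by omega)] at this
    simpa [label, visible, hl.trans_le hk₂] using this

/-- There are as many labels as choices inside some approximate square at the coarser scale. -/
theorem exists_labels (K₁ K₂ k₁ k₂ : ℕ) :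
    ∃ (d : ℕ → ℕ × ℕ) (L : Finset (Fin k₁ → ℕ × ℕ)), (∀ l, d l ∈ T.D l) ∧
      ∏ l ∈ Finset.range k₁, T.choices K₁ K₂ k₂ l ≤ L.card ∧
      ∀ t ∈ L, ∃ j : ℕ → ℕ × ℕ, (∀ l, j l ∈ T.D l) ∧ label k₁ k₂ j = t ∧
        (∀ l < K₁, (j l).1 = (d l).1) ∧ (∀ l < K₂, (j l).2 = (d l).2) := by
  -- A richest coarse square is found by taking, at each level, a digit in a fullest column.
  choose d hd hd' using fun l => exists_card_column_eq_colMax (T.nonempty l)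
  refine ⟨d, Fintype.piFinset fun l : Fin k₁ => (((T.D l).filter fun e =>
      ((l : ℕ) < K₁ → e.1 = (d l).1) ∧ ((l : ℕ) < K₂ → e.2 = (d l).2)).image
        (visible k₂ l)), hd, ?_, fun t ht => ?_⟩
  · rw [Fintype.card_piFinset, ← Fin.prod_univ_eq_prod_range]
    exact Finset.prod_le_prod' fun l _ => T.choices_le_card_image_visible (hd l) (hd' l)
  · simp only [Fintype.mem_piFinset, Finset.mem_image, Finset.mem_filter] at ht
    choose f hf hf' using ht
    refine ⟨extend d f, fun l => ?_, ?_, fun l hl => ?_, fun l hl => ?_⟩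
    · unfold extend
      split_ifs with h
      · exact (hf ⟨l, h⟩).1
      · exact hd l
    · funext l
      simp [label, extend, hf']
    · unfold extend
      split_ifs with h
      · exact (hf ⟨l, h⟩).2.1 hl
      · rfl
    · unfold extend
      split_ifs with h
      · exact (hf ⟨l, h⟩).2.2 hl
      · rfl

end DigitSeq

/-! ### Covering numbers of sets coded by a sequence of digit sets -/

theorem dist_le_abs_add_abs (x y : EuclideanSpace ℝ (Fin 2)) :
    dist x y ≤ |x 0 - y 0| + |x 1 - y 1| := by
  rw [EuclideanSpace.dist_eq, Fin.sum_univ_two, Real.dist_eq, Real.dist_eq]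
  refine Real.sqrt_le_iff.2 ⟨by positivity, ?_⟩
  nlinarith [abs_nonneg (x 0 - y 0), abs_nonneg (x 1 - y 1)]

theorem abs_sub_le_dist (x y : EuclideanSpace ℝ (Fin 2)) (i : Fin 2) :
    |x i - y i| ≤ dist x y := by
  rw [dist_eq_norm]
  simpa using PiLp.norm_apply_le (x - y) i

namespace DigitSeq

variable (T : DigitSeq)

/-- The level at which the columns have width comparable to `r`. -/
def colLevel (r : ℝ) : ℕ := levelOf T.m (2 / r)

/-- The level at which the rows have height comparable to `r`. -/
def rowLevel (r : ℝ) : ℕ := levelOf T.n (2 / r)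

/-- The number of approximate squares of side `r` in the richest one of side `R`. -/
def count (R r : ℝ) : ℕ :=
  ∏ l ∈ Finset.range (T.colLevel r), T.choices (T.colLevel R) (T.rowLevel R) (T.rowLevel r) l

/-- The rectangle of points with a given code up to levels `k₁` and `k₂`. -/
def rect (j : ℕ → ℕ × ℕ) (k₁ k₂ : ℕ) : Set (EuclideanSpace ℝ (Fin 2)) :=
  {z | z 0 ∈ digitInterval T.m (fun l => (j l).1) k₁ ∧
    z 1 ∈ digitInterval T.n (fun l => (j l).2) k₂}

/-- The set `F` consists of points with codes in the digit sets, and every such code belongs to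
a point of `F`. -/
structure Codes (F : Set (EuclideanSpace ℝ (Fin 2))) : Prop where
  exists_code : ∀ z ∈ F, ∀ k, ∃ j : ℕ → ℕ × ℕ, (∀ l < k, j l ∈ T.D l) ∧ z ∈ T.rect j k k
  exists_point : ∀ j : ℕ → ℕ × ℕ, (∀ l, j l ∈ T.D l) → ∃ z ∈ F, ∀ k, z ∈ T.rect j k k

theorem rowLevel_le_colLevel (r : ℝ) : T.rowLevel r ≤ T.colLevel r :=
  levelOf_le_levelOf T.two_le_m (fun l => (T.m_lt_n l).le) _

theorem colLevel_anti {r R : ℝ} (hr : 0 < r) (h : r ≤ R) : T.colLevel R ≤ T.colLevel r :=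
  levelOf_mono T.two_le_m (by gcongr)

theorem rowLevel_anti {r R : ℝ} (hr : 0 < r) (h : r ≤ R) : T.rowLevel R ≤ T.rowLevel r :=
  levelOf_mono T.two_le_n (by gcongr)

theorem choices_pos (K₁ K₂ k₂ l : ℕ) : 0 < T.choices K₁ K₂ k₂ l := by
  have h1 := colMax_pos (T.nonempty l)
  have h2 := colNum_pos (T.nonempty l)
  have h3 := Finset.card_pos.2 (T.nonempty l)
  unfold choices
  split_ifs <;> omega

theorem count_pos (R r : ℝ) : 0 < T.count R r :=
  Finset.prod_pos fun _ _ => T.choices_pos _ _ _ _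

theorem inv_base_colLevel_le {r : ℝ} (hr : 0 < r) :
    1 / (base T.m (T.colLevel r) : ℝ) ≤ r / 2 := by
  have := le_base_levelOf T.two_le_m (2 / r)
  rw [div_le_div_iff₀ (by exact_mod_cast base_pos T.two_le_m _) two_pos]
  rw [div_le_iff₀ hr] at this
  simpa [colLevel, mul_comm] using this

theorem inv_base_rowLevel_le {r : ℝ} (hr : 0 < r) :
    1 / (base T.n (T.rowLevel r) : ℝ) ≤ r / 2 := by
  have := le_base_levelOf T.two_le_n (2 / r)
  rw [div_le_div_iff₀ (by exact_mod_cast base_pos T.two_le_n _) two_pos]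
  rw [div_le_iff₀ hr] at this
  simpa [rowLevel, mul_comm] using this

theorem mul_base_colLevel_le {r : ℝ} (hr : 0 < r) (hr2 : r ≤ 2) :
    r * base T.m (T.colLevel r) ≤ 2 * T.H := by
  have := base_levelOf_le T.two_le_m T.m_le (t := 2 / r) (by rwa [le_div_iff₀ hr, one_mul])
  calc r * base T.m (T.colLevel r) ≤ r * (2 / r * T.H) := by gcongr; exact this
    _ = 2 * T.H := by field_simp

theorem mul_base_rowLevel_le {r : ℝ} (hr : 0 < r) (hr2 : r ≤ 2) :
    r * base T.n (T.rowLevel r) ≤ 2 * T.H := by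
  have := base_levelOf_le T.two_le_n T.n_le (t := 2 / r) (by rwa [le_div_iff₀ hr, one_mul])
  calc r * base T.n (T.rowLevel r) ≤ r * (2 / r * T.H) := by gcongr; exact this
    _ = 2 * T.H := by field_simp

/-- The factor 2 in the `2 / r` defining the levels makes both sides at most `r / 2`, so the
diameter is at most `r`. -/
theorem dist_le_of_mem_rect {j : ℕ → ℕ × ℕ} {r : ℝ} (hr : 0 < r)
    {x y : EuclideanSpace ℝ (Fin 2)} (hx : x ∈ T.rect j (T.colLevel r) (T.rowLevel r))
    (hy : y ∈ T.rect j (T.colLevel r) (T.rowLevel r)) : dist x y ≤ r := by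
  have h1 := abs_sub_le_of_mem_digitInterval hx.1 hy.1
  have h2 := abs_sub_le_of_mem_digitInterval hx.2 hy.2
  linarith [dist_le_abs_add_abs x y, T.inv_base_colLevel_le hr, T.inv_base_rowLevel_le hr]

theorem rect_subset {j : ℕ → ℕ × ℕ} {k K₁ K₂ : ℕ} (hj : ∀ l < k, j l ∈ T.D l) (h₁ : K₁ ≤ k)
    (h₂ : K₂ ≤ k) : T.rect j k k ⊆ T.rect j K₁ K₂ := fun _ hz =>
  ⟨digitInterval_subset T.two_le_m h₁ (fun l hl => T.fst_lt _ _ (hj l hl)) hz.1,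
    digitInterval_subset T.two_le_n h₂ (fun l hl => T.snd_lt _ _ (hj l hl)) hz.2⟩

theorem rect_congr {j j' : ℕ → ℕ × ℕ} {k₁ k₂ : ℕ} (h₁ : ∀ l < k₁, (j l).1 = (j' l).1)
    (h₂ : ∀ l < k₂, (j l).2 = (j' l).2) : T.rect j k₁ k₂ = T.rect j' k₁ k₂ := by
  simp only [rect, digitInterval_congr T.m h₁, digitInterval_congr T.n h₂]

/-- Close points lie in rectangles with close integer labels. -/
theorem digitVal_le_of_mem_rect {j j' : ℕ → ℕ × ℕ} {r : ℝ} (hr : 0 < r) (hr2 : r ≤ 2)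
    {x y : EuclideanSpace ℝ (Fin 2)} (hx : x ∈ T.rect j (T.colLevel r) (T.rowLevel r))
    (hy : y ∈ T.rect j' (T.colLevel r) (T.rowLevel r)) (h : dist x y ≤ 2 * r) :
    digitVal T.m (fun l => (j l).1) (T.colLevel r) ≤
        digitVal T.m (fun l => (j' l).1) (T.colLevel r) + (4 * T.H + 1) ∧
      digitVal T.n (fun l => (j l).2) (T.rowLevel r) ≤
        digitVal T.n (fun l => (j' l).2) (T.rowLevel r) + (4 * T.H + 1) := by
  refine ⟨digitVal_le_of_abs_sub_le T.two_le_m hx.1 hy.1 ((abs_sub_le_dist x y 0).trans h) ?_,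
    digitVal_le_of_abs_sub_le T.two_le_n hx.2 hy.2 ((abs_sub_le_dist x y 1).trans h) ?_⟩
  · push_cast
    linarith [T.mul_base_colLevel_le hr hr2]
  · push_cast
    linarith [T.mul_base_rowLevel_le hr hr2]

theorem label_eq_iff {k₁ k₂ : ℕ} (hk : k₂ ≤ k₁) {j j' : ℕ → ℕ × ℕ} :
    label k₁ k₂ j = label k₁ k₂ j' ↔
      (∀ l < k₁, (j l).1 = (j' l).1) ∧ ∀ l < k₂, (j l).2 = (j' l).2 := by
  constructor
  · intro h
    refine ⟨fun l hl => ?_, fun l hl => ?_⟩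
    · simpa [label, visible] using congrArg Prod.fst (congrFun h ⟨l, hl⟩)
    · simpa [label, visible, hl] using congrArg Prod.snd (congrFun h ⟨l, hl.trans_le hk⟩)
  · rintro ⟨h1, h2⟩
    funext l
    simp only [label, visible, h1 l l.2, Prod.mk.injEq, true_and]
    split_ifs with h
    · exact h2 l h
    · rfl

theorem extend_label {k₁ k₂ : ℕ} (hk : k₂ ≤ k₁) (d j : ℕ → ℕ × ℕ) :
    (∀ l < k₁, (extend d (label k₁ k₂ j) l).1 = (j l).1) ∧
      ∀ l < k₂, (extend d (label k₁ k₂ j) l).2 = (j l).2 :=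
  ⟨fun l hl => by simp [extend, hl, label, visible],
    fun l hl => by simp [extend, hl.trans_le hk, label, visible, hl]⟩

variable {T} {F : Set (EuclideanSpace ℝ (Fin 2))}

theorem Codes.nonempty (hF : T.Codes F) : F.Nonempty := by
  choose d hd using T.nonempty
  obtain ⟨z, hz, -⟩ := hF.exists_point d hd
  exact ⟨z, hz⟩

/-- Upper bound for the covering numbers of balls, and existence of optimal covers. -/
theorem Codes.coverNum_le (hF : T.Codes F) {r R : ℝ} (hr : 0 < r) (hrR : r ≤ R) (hR : R ≤ 2)
    (x : EuclideanSpace ℝ (Fin 2)) :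
    coverNum (Metric.closedBall x R ∩ F) r ≤ T.count R r * (4 * T.H + 2) ^ 2 ∧
      ∃ V : Fin (coverNum (Metric.closedBall x R ∩ F) r) → Set (EuclideanSpace ℝ (Fin 2)),
        (∀ i, Metric.ediam (V i) ≤ ENNReal.ofReal r) ∧
          Metric.closedBall x R ∩ F ⊆ ⋃ i, V i := by
  have hk := T.rowLevel_le_colLevel r
  have hK := T.rowLevel_le_colLevel R
  have hk₁ := T.colLevel_anti hr hrR
  have hk₂ := T.rowLevel_anti hr hrR
  set k₁ := T.colLevel r with hk₁'
  set k₂ := T.rowLevel r with hk₂'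
  -- The labels of all codes whose level-`k₁` rectangle meets the ball; the corresponding rectangles
  -- of scale `r` cover the part of `F` in it.
  set Ls : Set (Fin k₁ → ℕ × ℕ) := {t | ∃ j : ℕ → ℕ × ℕ, (∀ l < k₁, j l ∈ T.D l) ∧
    label k₁ k₂ j = t ∧ ∃ z ∈ Metric.closedBall x R, z ∈ T.rect j k₁ k₁} with hLs
  have hfin : Ls.Finite := by
    refine (Fintype.piFinset fun l : Fin k₁ =>
      (T.D l).image (visible k₂ l)).finite_toSet.subset ?_
    rintro _ ⟨j, hj, rfl, -⟩
    simp only [Finset.mem_coe, Fintype.mem_piFinset]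
    exact fun l => Finset.mem_image_of_mem _ (hj l l.2)
  have hcover := coverNum_le_card (E := Metric.closedBall x R ∩ F) (r := r) hfin.toFinset
    (fun t => T.rect (extend 0 t) k₁ k₂) (fun t _ => Metric.ediam_le fun y hy z hz => by
      rw [edist_dist]
      exact ENNReal.ofReal_le_ofReal (T.dist_le_of_mem_rect hr hy hz)) (by
    rintro z ⟨hzx, hzF⟩
    obtain ⟨j, hj, hz⟩ := hF.exists_code z hzF k₁
    refine mem_iUnion₂.2 ⟨label k₁ k₂ j, hfin.mem_toFinset.2 ⟨j, hj, rfl, z, hzx, hz⟩, ?_⟩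
    rw [T.rect_congr (extend_label hk 0 j).1 (extend_label hk 0 j).2]
    exact T.rect_subset hj le_rfl hk hz)
  refine ⟨hcover.1.trans ?_, hcover.2⟩
  refine T.card_label_le hK hk₂ hk₁ hk _ (fun t ht => ?_) ?_
  · obtain ⟨j, hj, hjt, -⟩ := hfin.mem_toFinset.1 ht
    exact ⟨j, hj, hjt⟩
  -- Two points of the ball are within `2 * R`, and `R` times either base is at most `2 * H`; hence
  -- integer labels differ by at most `4 * H + 1` in each coordinate.
  · refine card_le_sq_of_close _ (4 * T.H + 1) fun a ha b hb => ?_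
    obtain ⟨t, ht, rfl⟩ := Finset.mem_image.1 ha
    obtain ⟨t', ht', rfl⟩ := Finset.mem_image.1 hb
    obtain ⟨j, hj, rfl, z, hz, hzj⟩ := hfin.mem_toFinset.1 ht
    obtain ⟨j', hj', rfl, z', hz', hzj'⟩ := hfin.mem_toFinset.1 ht'
    have hd : dist z z' ≤ 2 * R := by
      linarith [dist_triangle_right z z' x, Metric.mem_closedBall.1 hz, Metric.mem_closedBall.1 hz']
    have key := T.digitVal_le_of_mem_rect (hr.trans_le hrR) hR
      (T.rect_subset hj hk₁ (hK.trans hk₁) hzj) (T.rect_subset hj' hk₁ (hK.trans hk₁) hzj') hd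
    have e := extend_label hk 0 j
    have e' := extend_label hk 0 j'
    simp only
    rw [digitVal_congr T.m fun l hl => e.1 l (hl.trans_le hk₁),
      digitVal_congr T.m fun l hl => e'.1 l (hl.trans_le hk₁),
      digitVal_congr T.n fun l hl => e.2 l (hl.trans_le hk₂),
      digitVal_congr T.n fun l hl => e'.2 l (hl.trans_le hk₂)]
    exact key

/-- Lower bound for the covering number of some ball. -/
theorem Codes.exists_le_coverNum (hF : T.Codes F) {r R : ℝ} (hr : 0 < r) (hrR : r ≤ R)
    (hR : R ≤ 2) : ∃ x ∈ F,
      T.count R r ≤ (4 * T.H + 2) ^ 2 * coverNum (Metric.closedBall x R ∩ F) r := by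
  have hk := T.rowLevel_le_colLevel r
  have hK := T.rowLevel_le_colLevel R
  obtain ⟨d, L, hd, hcard, hL⟩ :=
    T.exists_labels (T.colLevel R) (T.rowLevel R) (T.colLevel r) (T.rowLevel r)
  obtain ⟨x, hx, hxd⟩ := hF.exists_point d hd
  refine ⟨x, hx, hcard.trans ?_⟩
  obtain ⟨-, V, hV, hVc⟩ := hF.coverNum_le hr hrR hR x
  have hpt : ∀ t ∈ L, ∃ (j : ℕ → ℕ × ℕ) (z : EuclideanSpace ℝ (Fin 2)) (i : Fin _),
      (∀ l, j l ∈ T.D l) ∧ label (T.colLevel r) (T.rowLevel r) j = t ∧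
      z ∈ T.rect j (T.colLevel r) (T.rowLevel r) ∧ z ∈ V i := by
    intro t ht
    obtain ⟨j, hj, hjt, h1, h2⟩ := hL t ht
    obtain ⟨z, hz, hzj⟩ := hF.exists_point j hj
    -- The codes of `z` and `x` agree up to the coarse levels, so both points lie in one approximate
    -- square of diameter at most `R`.
    have hzx : z ∈ Metric.closedBall x R := by
      refine Metric.mem_closedBall.2 (T.dist_le_of_mem_rect (j := d) (hr.trans_le hrR) ?_ ?_)
      · rw [← T.rect_congr h1 h2]
        exact T.rect_subset (fun l _ => hj l) le_rfl hK (hzj _)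
      · exact T.rect_subset (fun l _ => hd l) le_rfl hK (hxd _)
    obtain ⟨i, hi⟩ := mem_iUnion.1 (hVc ⟨hzx, hz⟩)
    exact ⟨j, z, i, hj, hjt, T.rect_subset (fun l _ => hj l) le_rfl hk (hzj _), hi⟩
  choose! j z i hj hjt hzj hzi using hpt
  -- Each label is sent to a covering set containing its point. A set of diameter at most `r`
  -- receives at most `(4 * H + 2) ^ 2` labels, since the integer names of their squares are close.
  have hbound := Finset.card_le_mul_card_image_of_maps_to (s := L.attach) (t := Finset.univ)
    (f := fun t : {t // t ∈ L} => i t.1 t.2) (fun _ _ => Finset.mem_univ _) ((4 * T.H + 2) ^ 2)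
    fun i₀ _ => by
      rw [← Finset.card_image_of_injOn (f := fun t : {t // t ∈ L} =>
        (digitVal T.m (fun l => (j t.1 l).1) (T.colLevel r),
          digitVal T.n (fun l => (j t.1 l).2) (T.rowLevel r)))]
      · refine card_le_sq_of_close _ (4 * T.H + 1) fun a ha b hb => ?_
        obtain ⟨⟨t, ht⟩, hti, rfl⟩ := Finset.mem_image.1 ha
        obtain ⟨⟨t', ht'⟩, hti', rfl⟩ := Finset.mem_image.1 hb
        replace hti := (Finset.mem_filter.1 hti).2
        replace hti' := (Finset.mem_filter.1 hti').2
        simp only at hti hti'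
        refine T.digitVal_le_of_mem_rect hr (hrR.trans hR) (hzj t ht) (hzj t' ht') ?_
        have h1 := hzi t ht
        have h2 := hzi t' ht'
        rw [hti] at h1
        rw [hti'] at h2
        have h3 := (Metric.edist_le_ediam_of_mem h1 h2).trans (hV i₀)
        rw [edist_dist, ENNReal.ofReal_le_ofReal_iff hr.le] at h3
        linarith
      · rintro ⟨t, ht⟩ - ⟨t', ht'⟩ - h
        simp only [Prod.mk.injEq] at h
        refine Subtype.ext ?_
        simp only
        rw [← hjt t ht, ← hjt t' ht', label_eq_iff hk]
        exact ⟨digit_eq_of_digitVal_eq (fun l _ => T.fst_lt _ _ (hj t ht l))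
          (fun l _ => T.fst_lt _ _ (hj t' ht' l)) h.1,
          digit_eq_of_digitVal_eq (fun l _ => T.snd_lt _ _ (hj t ht l))
          (fun l _ => T.snd_lt _ _ (hj t' ht' l)) h.2⟩
  simpa using hbound

/-- At scale 2 both levels are 0 and the approximate square is the unit square. Global covering
numbers thus become the case `R = 2` of the ball estimates. -/
theorem Codes.subset_closedBall (hF : T.Codes F) {x : EuclideanSpace ℝ (Fin 2)} (hx : x ∈ F) :
    F ⊆ Metric.closedBall x 2 := by
  intro z hz
  obtain ⟨j, -, hj⟩ := hF.exists_code z hz 0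
  obtain ⟨j', -, hj'⟩ := hF.exists_code x hx 0
  refine Metric.mem_closedBall.2 (T.dist_le_of_mem_rect (j := j) two_pos ?_ ?_)
  · simpa [colLevel, rowLevel, levelOf_one] using hj
  · simpa [colLevel, rowLevel, levelOf_one, rect, digitInterval_zero] using hj'

theorem Codes.closedBall_two_inter (hF : T.Codes F) {x : EuclideanSpace ℝ (Fin 2)}
    (hx : x ∈ F) : Metric.closedBall x 2 ∩ F = F :=
  inter_eq_right.2 (hF.subset_closedBall hx)

end DigitSeq

/-! ### Carpets are coded by digit sequences -/

namespace Patterns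

variable {Λ : Type*} (S : Patterns Λ)

/-- The digits of the selected rectangles. -/
def digits (i : Λ) : Finset (ℕ × ℕ) := (S.rects i).image fun j => ((j.1 : ℕ), (j.2 : ℕ))

theorem digits_nonempty (i : Λ) : (S.digits i).Nonempty := (S.rects_nonempty i).image _

/-- The digit sets of the carpet of `ω`. -/
def digitSeq [Fintype Λ] (ω : ℕ → Λ) : DigitSeq where
  m l := S.m (ω l)
  n l := S.n (ω l)
  D l := S.digits (ω l)
  H := Finset.univ.sup S.n
  two_le_m l := S.two_le_m _
  m_lt_n l := S.m_lt_n _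
  n_le l := Finset.le_sup (Finset.mem_univ _)
  fst_lt l d hd := by
    obtain ⟨j, -, rfl⟩ := Finset.mem_image.1 hd
    exact j.1.2
  snd_lt l d hd := by
    obtain ⟨j, -, rfl⟩ := Finset.mem_image.1 hd
    exact j.2.2
  nonempty l := S.digits_nonempty _

theorem cylMap_apply_zero (ω : ℕ → Λ) (j : (l : ℕ) → Fin (S.m (ω l)) × Fin (S.n (ω l)))
    (k : ℕ) (z : EuclideanSpace ℝ (Fin 2)) :
    S.cylMap ω j k z 0 = (digitVal (fun l => S.m (ω l)) (fun l => ((j l).1 : ℕ)) k + z 0) /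
      base (fun l => S.m (ω l)) k := by
  induction k generalizing z with
  | zero => simp [cylMap, digitVal, base]
  | succ k ih =>
    have : (S.m (ω k) : ℝ) ≠ 0 := by have := S.two_le_m (ω k); positivity
    have hb : (base (fun l => S.m (ω l)) k : ℝ) ≠ 0 := by
      exact_mod_cast (base_pos (fun l => S.two_le_m _) k).ne'
    simp only [cylMap, Function.comp_apply, ih, digitVal, base_succ, rectMap]
    push_cast
    field_simp
    ring

theorem cylMap_apply_one (ω : ℕ → Λ) (j : (l : ℕ) → Fin (S.m (ω l)) × Fin (S.n (ω l)))
    (k : ℕ) (z : EuclideanSpace ℝ (Fin 2)) :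
    S.cylMap ω j k z 1 = (digitVal (fun l => S.n (ω l)) (fun l => ((j l).2 : ℕ)) k + z 1) /
      base (fun l => S.n (ω l)) k := by
  induction k generalizing z with
  | zero => simp [cylMap, digitVal, base]
  | succ k ih =>
    have hn : ∀ i, 2 ≤ S.n i := fun i => (S.two_le_m i).trans (S.m_lt_n i).le
    have : (S.n (ω k) : ℝ) ≠ 0 := by have := hn (ω k); positivity
    have hb : (base (fun l => S.n (ω l)) k : ℝ) ≠ 0 := by
      exact_mod_cast (base_pos (fun l => hn _) k).ne'
    simp only [cylMap, Function.comp_apply, ih, digitVal, base_succ, rectMap]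
    push_cast
    field_simp
    ring

theorem mem_digitInterval_of_eq {m a : ℕ → ℕ} (hm : ∀ l, 2 ≤ m l) {k : ℕ} {x : ℝ}
    (hx : x ∈ Icc (0 : ℝ) 1) : (digitVal m a k + x) / base m k ∈ digitInterval m a k := by
  have hb : (0 : ℝ) < base m k := by exact_mod_cast base_pos hm k
  constructor
  · gcongr; linarith [hx.1]
  · gcongr; exact hx.2

theorem image_cylMap_subset_rect [Fintype Λ] (ω : ℕ → Λ)
    (j : (l : ℕ) → Fin (S.m (ω l)) × Fin (S.n (ω l))) (k : ℕ) :
    S.cylMap ω j k '' unitSquare ⊆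
      (S.digitSeq ω).rect (fun l => ((j l).1, (j l).2)) k k := by
  rintro _ ⟨z, hz, rfl⟩
  constructor
  · rw [cylMap_apply_zero]
    exact mem_digitInterval_of_eq (S.digitSeq ω).two_le_m (hz 0)
  · rw [cylMap_apply_one]
    exact mem_digitInterval_of_eq (S.digitSeq ω).two_le_n (hz 1)

theorem isCompact_unitSquare : IsCompact unitSquare := by
  have : unitSquare = (EuclideanSpace.equiv (Fin 2) ℝ).symm ''
      (Set.univ.pi fun _ => Icc (0 : ℝ) 1) := by
    ext z
    constructor
    · intro hz
      exact ⟨z, fun t _ => hz t, rfl⟩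
    · rintro ⟨w, hw, rfl⟩ t
      exact hw t (Set.mem_univ t)
  rw [this]
  exact (isCompact_univ_pi fun _ => isCompact_Icc).image (ContinuousLinearEquiv.continuous _)

theorem continuous_rectMap (i : Λ) (j : Fin (S.m i) × Fin (S.n i)) :
    Continuous (S.rectMap i j) := by
  refine (PiLp.continuous_toLp 2 _).comp (continuous_pi fun t => ?_)
  fin_cases t
  · simp only [Fin.zero_eta, Matrix.cons_val_zero]; fun_prop
  · simp only [Fin.mk_one, Matrix.cons_val_one, Matrix.cons_val_fin_one]; fun_prop

theorem rectMap_mem_unitSquare (i : Λ) (j : Fin (S.m i) × Fin (S.n i))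
    {z : EuclideanSpace ℝ (Fin 2)} (hz : z ∈ unitSquare) : S.rectMap i j z ∈ unitSquare := by
  have key : ∀ (N : ℕ) (a : Fin N) (x : ℝ), x ∈ Icc (0 : ℝ) 1 →
      ((a : ℕ) + x) / (N : ℝ) ∈ Icc (0 : ℝ) 1 := by
    intro N a x hx
    have ha : ((a : ℕ) : ℝ) + 1 ≤ N := by exact_mod_cast a.2
    have ha0 : (0 : ℝ) ≤ (a : ℕ) := Nat.cast_nonneg _
    exact ⟨div_nonneg (by linarith [hx.1]) (by linarith),
      div_le_one_of_le₀ (by linarith [hx.2]) (by linarith)⟩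
  intro t
  fin_cases t
  · exact key _ j.1 _ (hz 0)
  · exact key _ j.2 _ (hz 1)

theorem continuous_cylMap (ω : ℕ → Λ) (j : (l : ℕ) → Fin (S.m (ω l)) × Fin (S.n (ω l)))
    (k : ℕ) : Continuous (S.cylMap ω j k) := by
  induction k with
  | zero => exact continuous_id
  | succ k ih => exact ih.comp (S.continuous_rectMap _ _)

theorem codes_carpet [Fintype Λ] (ω : ℕ → Λ) : (S.digitSeq ω).Codes (S.carpet ω) where
  exists_code z hz k := by
    -- The carpet is an intersection over levels at least 1, so level `k + 1` is used to include `k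
    -- = 0`.
    have hz' := mem_iInter₂.1 hz (k + 1) (by omega)
    obtain ⟨j, hj, hzj⟩ := hz'
    have hD : ∀ l < k + 1, ((fun l => ((j l).1, (j l).2) : ℕ → ℕ × ℕ) l) ∈
        (S.digitSeq ω).D l := fun l hl => Finset.mem_image_of_mem _ (hj l hl)
    exact ⟨fun l => ((j l).1, (j l).2), fun l hl => hD l (by omega),
      (S.digitSeq ω).rect_subset hD (by omega) (by omega) (S.image_cylMap_subset_rect ω j _ hzj)⟩
  exists_point j hj := by
    choose i hi hij using fun l => Finset.mem_image.1 (hj l)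
    have hji : j = fun l => (((i l).1 : ℕ), ((i l).2 : ℕ)) := funext fun l => (hij l).symm
    -- Cantor's intersection theorem for the nested compact cylinders of one code.
    have hne : (⋂ k, S.cylMap ω i k '' unitSquare).Nonempty := by
      refine IsCompact.nonempty_iInter_of_sequence_nonempty_isCompact_isClosed _
        (fun k => ?_) (fun k => ?_) (isCompact_unitSquare.image (S.continuous_cylMap ω i 0))
        fun k => (isCompact_unitSquare.image (S.continuous_cylMap ω i k)).isClosed
      · rintro _ ⟨z, hz, rfl⟩
        exact ⟨_, S.rectMap_mem_unitSquare _ (i k) hz, rfl⟩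
      · exact Nonempty.image _ ⟨0, fun t => by simp⟩
    obtain ⟨z, hz⟩ := hne
    rw [mem_iInter] at hz
    refine ⟨z, mem_iInter₂.2 fun k _ => ⟨i, fun l _ => hi l, hz k⟩, fun k => ?_⟩
    rw [hji]
    exact S.image_cylMap_subset_rect ω i k (hz k)

end Patterns

/-! ### Growth along levels -/

/-- Partial sums of the logarithms of a sequence of integers. -/
def logSum (X : ℕ → ℕ) (k : ℕ) : ℝ := ∑ l ∈ Finset.range k, Real.log (X l)

theorem logSum_mono (X : ℕ → ℕ) : Monotone (logSum X) :=
  monotone_nat_of_le_succ fun k => by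
    rw [logSum, logSum, Finset.sum_range_succ]
    linarith [Real.log_natCast_nonneg (X k)]

theorem logSum_zero (X : ℕ → ℕ) : logSum X 0 = 0 := by simp [logSum]

theorem logSum_nonneg (X : ℕ → ℕ) (k : ℕ) : 0 ≤ logSum X k :=
  Finset.sum_nonneg fun _ _ => Real.log_natCast_nonneg _

theorem log_base {m : ℕ → ℕ} (hm : ∀ l, 2 ≤ m l) (k : ℕ) :
    Real.log (base m k) = logSum m k := by
  rw [base, Nat.cast_prod, Real.log_prod fun i _ => ?_]
  · rfl
  · have := hm i
    positivity

theorem sum_range_ite_lt (f : ℕ → ℝ) {a k : ℕ} (h : a ≤ k) :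
    ∑ l ∈ Finset.range k, (if l < a then f l else 0) = ∑ l ∈ Finset.range a, f l := by
  rw [← Finset.sum_filter]
  congr 1
  ext l
  simp only [Finset.mem_filter, Finset.mem_range]
  omega

theorem tendsto_levelOf {m : ℕ → ℕ} (hm : ∀ l, 2 ≤ m l) : Tendsto (levelOf m) atTop atTop := by
  refine tendsto_atTop.2 fun k => ?_
  filter_upwards [eventually_gt_atTop (base m k : ℝ)] with t ht
  by_contra! h
  have h1 := le_base_levelOf hm t
  have h2 : (base m (levelOf m t) : ℝ) ≤ base m k := by exact_mod_cast base_mono hm h.le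
  linarith

theorem tendsto_log_one_div : Tendsto (fun r : ℝ => Real.log (1 / r)) (𝓝[>] 0) atTop := by
  simp only [one_div]
  exact Real.tendsto_log_atTop.comp tendsto_inv_nhdsGT_zero

/-- At the level k selected by `2 / r`, the sum of log m is log(1/r) + O(1), so k ~ log(1/r)/a; the
sum of log X is then asymptotic to k x in the averaged sense. -/
theorem tendsto_logSum_levelOf {m X : ℕ → ℕ} {H : ℕ} {x a : ℝ} (hm : ∀ l, 2 ≤ m l)
    (hH : ∀ l, m l ≤ H) (ha : 0 < a) (hma : Tendsto (fun k : ℕ => logSum m k / k) atTop (𝓝 a))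
    (hX : Tendsto (fun k : ℕ => logSum X k / k) atTop (𝓝 x)) :
    Tendsto (fun r : ℝ => logSum X (levelOf m (2 / r)) / Real.log (1 / r)) (𝓝[>] 0)
      (𝓝 (x / a)) := by
  have hlev : Tendsto (fun r : ℝ => levelOf m (2 / r)) (𝓝[>] 0) atTop := by
    refine (tendsto_levelOf hm).comp ?_
    exact (tendsto_inv_nhdsGT_zero.const_mul_atTop two_pos).congr fun r => (div_eq_mul_inv 2 r).symm
  have h1 : Tendsto (fun r : ℝ => logSum m (levelOf m (2 / r)) / Real.log (1 / r)) (𝓝[>] 0)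
      (𝓝 1) := by
    have hl : ∀ c : ℝ, Tendsto (fun r : ℝ => 1 + c / Real.log (1 / r)) (𝓝[>] 0) (𝓝 1) :=
      fun c => by simpa using (tendsto_log_one_div.const_div_atTop c).const_add 1
    refine tendsto_of_tendsto_of_tendsto_of_le_of_le' (hl 0) (hl (Real.log 2 + Real.log H)) ?_ ?_
    all_goals
      filter_upwards [tendsto_log_one_div.eventually_gt_atTop 0, self_mem_nhdsWithin,
        Ioo_mem_nhdsGT (zero_lt_one (α := ℝ))] with r hr (hr0 : 0 < r) hr1
      have hb : (0 : ℝ) < base m (levelOf m (2 / r)) := by exact_mod_cast base_pos hm _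
      have hlog : Real.log (2 / r) = Real.log 2 + Real.log (1 / r) := by
        rw [← Real.log_mul two_ne_zero (by positivity), mul_one_div]
      rw [← log_base hm]
    · rw [zero_div, add_zero, le_div_iff₀ hr, one_mul]
      have := Real.log_le_log (by positivity) (le_base_levelOf hm (2 / r))
      linarith [Real.log_pos one_lt_two]
    · have hH0 : (0 : ℝ) < H := by
        exact_mod_cast (by have := hm 0; have := hH 0; omega : 0 < H)
      rw [div_le_iff₀ hr, add_mul, one_mul, div_mul_cancel₀ _ hr.ne']
      have := Real.log_le_log hb (base_levelOf_le hm hH (t := 2 / r)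
        (by rw [le_div_iff₀ hr0]; linarith [hr1.2]))
      rw [Real.log_mul (by positivity) hH0.ne', hlog] at this
      linarith
  have h2 := ((hX.comp hlev).div (hma.comp hlev) ha.ne').mul h1
  rw [mul_one] at h2
  refine h2.congr' ?_
  filter_upwards [hlev.eventually_gt_atTop 0] with r hr
  have hk : ((levelOf m (2 / r) : ℕ) : ℝ) ≠ 0 := by exact_mod_cast hr.ne'
  have hpos : logSum m (levelOf m (2 / r)) ≠ 0 := by
    rw [← log_base hm]
    refine (Real.log_pos ?_).ne'
    have := two_pow_le_base hm (levelOf m (2 / r))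
    have h2 := Nat.one_lt_two_pow hr.ne'
    exact_mod_cast h2.trans_le this
  simp only [Function.comp_apply, Pi.div_apply]
  field_simp

/-- An error estimate which is uniform over all scales below `1`. -/
theorem exists_abs_sub_le {f : ℝ → ℝ} {x : ℝ} (hf : ∀ r, 0 ≤ f r)
    (hanti : ∀ r R, 0 < r → r ≤ R → f R ≤ f r)
    (h : Tendsto (fun r : ℝ => f r / Real.log (1 / r)) (𝓝[>] 0) (𝓝 x)) {ε : ℝ} (hε : 0 < ε) :
    ∃ K : ℝ, ∀ r, 0 < r → r < 1 → |f r - x * Real.log (1 / r)| ≤ ε * Real.log (1 / r) + K := by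
  have h1 := (h.eventually (Metric.closedBall_mem_nhds x hε)).and
    (tendsto_log_one_div.eventually_gt_atTop 0)
  obtain ⟨r₀, hr₀, hsub⟩ := mem_nhdsGT_iff_exists_Ioo_subset.1 h1
  have hr₀' : (0 : ℝ) < r₀ := hr₀
  refine ⟨f r₀ + |x| * |Real.log (1 / r₀)|, fun r hr hr1 => ?_⟩
  have hL : 0 < Real.log (1 / r) := Real.log_pos (by rw [lt_div_iff₀ hr]; linarith)
  rcases lt_or_ge r r₀ with hlt | hge
  · have h2 := (hsub ⟨hr, hlt⟩).1
    rw [Real.dist_eq] at h2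
    have h3 : |f r - x * Real.log (1 / r)| = |f r / Real.log (1 / r) - x| * Real.log (1 / r) := by
      rw [← abs_of_pos hL, ← abs_mul, abs_of_pos hL, sub_mul, div_mul_cancel₀ _ hL.ne']
    rw [h3]
    have h4 := mul_le_mul_of_nonneg_right h2 hL.le
    have h5 := hf r₀
    have h6 : 0 ≤ |x| * |Real.log (1 / r₀)| := by positivity
    linarith
  -- Away from 0, monotonicity bounds `f r` by `f r₀`, which the constant absorbs.
  · have h2 := hanti r₀ r hr₀' hge
    have h3 : Real.log (1 / r) ≤ |Real.log (1 / r₀)| :=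
      (Real.log_le_log (by positivity) (by gcongr)).trans (le_abs_self _)
    have h4 : |x * Real.log (1 / r)| ≤ |x| * |Real.log (1 / r₀)| := by
      rw [abs_mul, abs_of_pos hL]
      gcongr
    calc |f r - x * Real.log (1 / r)| ≤ |f r| + |x * Real.log (1 / r)| := abs_sub _ _
      _ ≤ ε * Real.log (1 / r) + (f r₀ + |x| * |Real.log (1 / r₀)|) := by
        rw [abs_of_nonneg (hf r)]
        have := mul_pos hε hL
        linarith

/-! ### Logarithms of the counts and their limits -/

namespace DigitSeq

variable (T : DigitSeq)

/-- The total number of digits at each level. -/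
def cardSeq (l : ℕ) : ℕ := (T.D l).card

/-- The number of columns at each level. -/
def colNumSeq (l : ℕ) : ℕ := colNum (T.D l)

/-- The maximal number of digits in a column at each level. -/
def colMaxSeq (l : ℕ) : ℕ := colMax (T.D l)

theorem log_count_eq_sum (R r : ℝ) :
    Real.log (T.count R r) = ∑ l ∈ Finset.range (T.colLevel r),
      Real.log (T.choices (T.colLevel R) (T.rowLevel R) (T.rowLevel r) l) := by
  rw [count, Nat.cast_prod, Real.log_prod fun i _ => ?_]
  exact_mod_cast (T.choices_pos _ _ _ _).ne'

theorem log_count {R r : ℝ} (hr : 0 < r) (hrR : r ≤ R) :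
    Real.log (T.count R r) =
      (min (logSum T.colMaxSeq (T.colLevel R)) (logSum T.colMaxSeq (T.rowLevel r))
        - logSum T.colMaxSeq (T.rowLevel R)) +
      (max (logSum T.cardSeq (T.colLevel R)) (logSum T.cardSeq (T.rowLevel r))
        - logSum T.cardSeq (T.colLevel R)) +
      (logSum T.colNumSeq (T.colLevel r) -
        max (logSum T.colNumSeq (T.colLevel R)) (logSum T.colNumSeq (T.rowLevel r))) := by
  have hk := T.rowLevel_le_colLevel r
  have hK := T.rowLevel_le_colLevel R
  have hk₁ := T.colLevel_anti hr hrR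
  have hk₂ := T.rowLevel_anti hr hrR
  rw [log_count_eq_sum, ← (logSum_mono _).map_min, ← (logSum_mono _).map_max,
    ← (logSum_mono _).map_max]
  simp only [logSum]
  -- All partial sums are written over one range with indicators, so that the identity can be
  -- checked at each level.
  rw [← sum_range_ite_lt _ ((min_le_left _ _).trans hk₁), ← sum_range_ite_lt _ (hK.trans hk₁),
    ← sum_range_ite_lt _ (max_le hk₁ hk), ← sum_range_ite_lt _ hk₁,
    ← sum_range_ite_lt (a := max _ _) _ (max_le hk₁ hk), ← Finset.sum_sub_distrib,
    ← Finset.sum_sub_distrib, ← Finset.sum_sub_distrib, ← Finset.sum_add_distrib,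
    ← Finset.sum_add_distrib]
  refine Finset.sum_congr rfl fun l _ => ?_
  simp only [lt_min_iff, lt_max_iff, choices, colMaxSeq, cardSeq, colNumSeq]
  by_cases h1 : l < T.rowLevel R
  · simp [h1, h1.trans_le hK, h1.trans_le hk₂]
  · by_cases h2 : l < T.colLevel R <;> by_cases h3 : l < T.rowLevel r <;> simp [h1, h2, h3]

/-- Replacing |D| by (largest column)(column number) decouples rows from columns. The resulting
bound has no case distinction and serves all pairs of scales. -/
theorem log_count_le {R r : ℝ} (hr : 0 < r) (hrR : r ≤ R) :
    Real.log (T.count R r) ≤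
      (logSum T.colMaxSeq (T.rowLevel r) - logSum T.colMaxSeq (T.rowLevel R)) +
      (logSum T.colNumSeq (T.colLevel r) - logSum T.colNumSeq (T.colLevel R)) := by
  have hk := T.rowLevel_le_colLevel r
  have hK := T.rowLevel_le_colLevel R
  have hk₁ := T.colLevel_anti hr hrR
  have hk₂ := T.rowLevel_anti hr hrR
  rw [log_count_eq_sum]
  simp only [logSum]
  rw [← sum_range_ite_lt _ hk, ← sum_range_ite_lt _ (hK.trans hk₁), ← sum_range_ite_lt _ hk₁,
    ← Finset.sum_sub_distrib, ← Finset.sum_sub_distrib, ← Finset.sum_add_distrib]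
  refine Finset.sum_le_sum fun l _ => ?_
  have hN : Real.log (T.D l).card ≤ Real.log (colMax (T.D l)) + Real.log (colNum (T.D l)) := by
    have h1 := colMax_pos (T.nonempty l)
    have h2 := colNum_pos (T.nonempty l)
    have h3 := Finset.card_pos.2 (T.nonempty l)
    rw [← Real.log_mul (by positivity) (by positivity)]
    exact Real.log_le_log (by positivity) (by exact_mod_cast card_le_colNum_mul_colMax (T.D l))
  have hC := Real.log_natCast_nonneg (colMax (T.D l))
  simp only [choices, colMaxSeq, colNumSeq]
  by_cases h1 : l < T.rowLevel R
  · simp [h1, h1.trans_le hK, h1.trans_le hk₂]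
  · by_cases h2 : l < T.colLevel R <;> by_cases h3 : l < T.rowLevel r <;> simp [h1, h2, h3, hN]

/-- The logarithmic averages of the bases and of the numbers of choices converge. -/
structure HasAverages (a b γ η β : ℝ) : Prop where
  m : Tendsto (fun k : ℕ => logSum T.m k / k) atTop (𝓝 a)
  n : Tendsto (fun k : ℕ => logSum T.n k / k) atTop (𝓝 b)
  colMax : Tendsto (fun k : ℕ => logSum T.colMaxSeq k / k) atTop (𝓝 γ)
  card : Tendsto (fun k : ℕ => logSum T.cardSeq k / k) atTop (𝓝 η)
  colNum : Tendsto (fun k : ℕ => logSum T.colNumSeq k / k) atTop (𝓝 β)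
  m_pos : 0 < a
  m_lt_n : a < b
  colMax_nonneg : 0 ≤ γ
  card_nonneg : 0 ≤ η
  colNum_nonneg : 0 ≤ β
  card_le : η ≤ γ + β

variable {T} {a b γ η β : ℝ}

theorem HasAverages.n_pos (h : T.HasAverages a b γ η β) : 0 < b := h.m_pos.trans h.m_lt_n

theorem HasAverages.tendsto_colLevel (h : T.HasAverages a b γ η β) {X : ℕ → ℕ} {x : ℝ}
    (hX : Tendsto (fun k : ℕ => logSum X k / k) atTop (𝓝 x)) :
    Tendsto (fun r : ℝ => logSum X (T.colLevel r) / Real.log (1 / r)) (𝓝[>] 0) (𝓝 (x / a)) :=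
  tendsto_logSum_levelOf T.two_le_m T.m_le h.m_pos h.m hX

theorem HasAverages.tendsto_rowLevel (h : T.HasAverages a b γ η β) {X : ℕ → ℕ} {x : ℝ}
    (hX : Tendsto (fun k : ℕ => logSum X k / k) atTop (𝓝 x)) :
    Tendsto (fun r : ℝ => logSum X (T.rowLevel r) / Real.log (1 / r)) (𝓝[>] 0) (𝓝 (x / b)) :=
  tendsto_logSum_levelOf T.two_le_n T.n_le h.n_pos h.n hX

theorem log_one_div_rpow {θ R : ℝ} (hR : 0 < R) :
    Real.log (1 / R ^ (1 / θ)) = Real.log (1 / R) / θ := by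
  rw [one_div (R ^ _), Real.log_inv, Real.log_rpow hR, one_div R, Real.log_inv]
  ring

theorem tendsto_comp_rpow {f : ℝ → ℝ} {x θ : ℝ} (hθ : 0 < θ)
    (h : Tendsto (fun r : ℝ => f r / Real.log (1 / r)) (𝓝[>] 0) (𝓝 x)) :
    Tendsto (fun R : ℝ => f (R ^ (1 / θ)) / Real.log (1 / R)) (𝓝[>] 0) (𝓝 (x / θ)) := by
  have hpow : Tendsto (fun R : ℝ => R ^ (1 / θ)) (𝓝[>] 0) (𝓝[>] 0) := by
    refine tendsto_nhdsWithin_iff.2 ⟨?_, ?_⟩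
    · have := (Real.continuousAt_rpow_const 0 (1 / θ) (Or.inr (by positivity))).tendsto
      rw [Real.zero_rpow (by positivity)] at this
      exact this.mono_left nhdsWithin_le_nhds
    · filter_upwards [self_mem_nhdsWithin] with R hR
      exact Real.rpow_pos_of_pos hR _
  refine ((h.comp hpow).div_const θ).congr' ?_
  filter_upwards [self_mem_nhdsWithin] with R hR
  simp only [Function.comp_apply, log_one_div_rpow (mem_Ioi.1 hR)]
  field_simp

theorem rpow_one_div_le {θ R : ℝ} (hθ : 0 < θ) (hθ1 : θ < 1) (hR : 0 < R) (hR1 : R ≤ 1) :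
    R ^ (1 / θ) ≤ R := by
  have := Real.rpow_le_rpow_of_exponent_ge hR hR1 (one_le_one_div hθ hθ1.le)
  rwa [Real.rpow_one] at this

theorem HasAverages.tendsto_log_count (h : T.HasAverages a b γ η β) {θ : ℝ} (hθ : 0 < θ)
    (hθ1 : θ < 1) :
    Tendsto (fun R : ℝ => Real.log (T.count R (R ^ (1 / θ))) / Real.log (1 / R)) (𝓝[>] 0)
      (𝓝 ((min (γ / a) (γ / b / θ) - γ / b) + (max (η / a) (η / b / θ) - η / a) +
        (β / a / θ - max (β / a) (β / b / θ)))) := by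
  have main := ((((h.tendsto_colLevel h.colMax).min
    (tendsto_comp_rpow hθ (h.tendsto_rowLevel h.colMax))).sub (h.tendsto_rowLevel h.colMax)).add
    (((h.tendsto_colLevel h.card).max (tendsto_comp_rpow hθ (h.tendsto_rowLevel h.card))).sub
      (h.tendsto_colLevel h.card))).add
    ((tendsto_comp_rpow hθ (h.tendsto_colLevel h.colNum)).sub
      ((h.tendsto_colLevel h.colNum).max (tendsto_comp_rpow hθ (h.tendsto_rowLevel h.colNum))))
  refine main.congr' ?_
  filter_upwards [tendsto_log_one_div.eventually_gt_atTop 0,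
    Ioo_mem_nhdsGT (zero_lt_one (α := ℝ))] with R hL hR
  rw [T.log_count (Real.rpow_pos_of_pos hR.1 _) (rpow_one_div_le hθ hθ1 hR.1 hR.2.le),
    min_div_div_right hL.le, max_div_div_right hL.le, max_div_div_right hL.le]
  ring

theorem colLevel_two : T.colLevel 2 = 0 := by simp [colLevel, levelOf_one]

theorem rowLevel_two : T.rowLevel 2 = 0 := by simp [rowLevel, levelOf_one]

theorem HasAverages.tendsto_log_count_two (h : T.HasAverages a b γ η β) :
    Tendsto (fun r : ℝ => Real.log (T.count 2 r) / Real.log (1 / r)) (𝓝[>] 0)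
      (𝓝 (η / b + (β / a - β / b))) := by
  refine ((h.tendsto_rowLevel h.card).add
    ((h.tendsto_colLevel h.colNum).sub (h.tendsto_rowLevel h.colNum))).congr' ?_
  filter_upwards [Ioo_mem_nhdsGT (zero_lt_two (α := ℝ))] with r hr
  rw [T.log_count hr.1 hr.2.le, colLevel_two, rowLevel_two]
  simp only [logSum_zero, min_eq_left (logSum_nonneg _ _), max_eq_right (logSum_nonneg _ _)]
  ring

/-! ### Dimensions of coded sets -/

variable {F : Set (EuclideanSpace ℝ (Fin 2))}

theorem Codes.coverNum_le_coverNum (hF : T.Codes F) {r r' R : ℝ} (hr' : 0 < r') (hr'2 : r' ≤ 2)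
    (h : r' ≤ r) (x : EuclideanSpace ℝ (Fin 2)) :
    coverNum (Metric.closedBall x R ∩ F) r ≤ coverNum F r' := by
  obtain ⟨y, hy⟩ := hF.nonempty
  have hcov := (hF.coverNum_le hr' hr'2 le_rfl y).2
  rw [hF.closedBall_two_inter hy] at hcov
  obtain ⟨V, hV, hVF⟩ := hcov
  exact Nat.sInf_le ⟨V, fun i => (hV i).trans (ENNReal.ofReal_le_ofReal h),
    inter_subset_right.trans hVF⟩

theorem le_rpow_of_log_le {x y α : ℝ} (hx : 0 < x) (hy : 0 < y)
    (h : Real.log x ≤ α * Real.log y) : x ≤ y ^ α := by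
  rw [← Real.log_le_log_iff hx (Real.rpow_pos_of_pos hy _), Real.log_rpow hy]
  exact h

theorem count_cast_pos (R r : ℝ) : (0 : ℝ) < T.count R r := by exact_mod_cast T.count_pos R r

theorem log_div_rpow {θ R : ℝ} (hR : 0 < R) :
    Real.log (R / R ^ (1 / θ)) = (1 / θ - 1) * Real.log (1 / R) := by
  rw [Real.log_div hR.ne' (Real.rpow_pos_of_pos hR _).ne', Real.log_rpow hR, one_div R,
    Real.log_inv]
  ring

theorem limit_nonneg {X : ℝ → ℕ} {s : ℝ}
    (hs : Tendsto (fun R : ℝ => Real.log (X R) / Real.log (1 / R)) (𝓝[>] 0) (𝓝 s)) :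
    0 ≤ s := by
  refine ge_of_tendsto hs ?_
  filter_upwards [tendsto_log_one_div.eventually_gt_atTop 0] with R hL
  exact div_nonneg (Real.log_natCast_nonneg _) hL.le

/-- For small `R` the limit bounds the count. The remaining `R` are absorbed by one covering number
of `F`, because `α ≥ 0` keeps the right-hand power at least 1. -/
theorem Codes.exists_bound_of_lt (hF : T.Codes F) {θ s α : ℝ} (hθ : 0 < θ) (hθ1 : θ < 1)
    (hs : Tendsto (fun R : ℝ => Real.log (T.count R (R ^ (1 / θ))) / Real.log (1 / R)) (𝓝[>] 0)
      (𝓝 s)) (hα : s < α * (1 / θ - 1)) :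
    ∃ C : ℝ, 0 < C ∧ ∀ R : ℝ, 0 < R → R < 1 → ∀ x ∈ F,
      (coverNum (Metric.closedBall x R ∩ F) (R ^ (1 / θ)) : ℝ) ≤ C * (R / R ^ (1 / θ)) ^ α := by
  have hs0 : 0 ≤ s := limit_nonneg hs
  have hθ' : 0 < 1 / θ - 1 := by have := one_lt_one_div hθ hθ1; linarith
  have hα0 : 0 ≤ α := by
    by_contra! h
    nlinarith
  obtain ⟨R₀, hR₀, hsub⟩ := mem_nhdsGT_iff_exists_Ioo_subset.1
    ((hs.eventually_lt_const hα).and (tendsto_log_one_div.eventually_gt_atTop 0))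
  have hR₀' : (0 : ℝ) < min R₀ 1 := lt_min hR₀ one_pos
  set r₀ := (min R₀ 1) ^ (1 / θ) with hr₀
  have hr₀pos : 0 < r₀ := Real.rpow_pos_of_pos hR₀' _
  have hr₀1 : r₀ ≤ 1 := Real.rpow_le_one hR₀'.le (min_le_right _ _) (by positivity)
  refine ⟨(4 * T.H + 2) ^ 2 + coverNum F r₀, by positivity, fun R hR hR1 x _ => ?_⟩
  have hpow : 0 < R ^ (1 / θ) := Real.rpow_pos_of_pos hR _
  have hle := rpow_one_div_le hθ hθ1 hR hR1.le
  rcases lt_or_ge R (min R₀ 1) with hlt | hge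
  · have h1 := hsub ⟨hR, hlt.trans_le (min_le_left _ _)⟩
    have h2 : (T.count R (R ^ (1 / θ)) : ℝ) ≤ (R / R ^ (1 / θ)) ^ α := by
      refine le_rpow_of_log_le (count_cast_pos _ _) (by positivity) ?_
      rw [log_div_rpow hR, ← mul_assoc]
      exact ((div_lt_iff₀ h1.2).1 h1.1).le
    have h3 : (coverNum (Metric.closedBall x R ∩ F) (R ^ (1 / θ)) : ℝ) ≤
        T.count R (R ^ (1 / θ)) * (4 * T.H + 2) ^ 2 := by
      exact_mod_cast (hF.coverNum_le hpow hle (by linarith) x).1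
    calc _ ≤ _ := h3
      _ ≤ (R / R ^ (1 / θ)) ^ α * (4 * T.H + 2) ^ 2 := by gcongr
      _ ≤ _ := by
        rw [mul_comm]
        gcongr
        simp
  · have h1 : (coverNum (Metric.closedBall x R ∩ F) (R ^ (1 / θ)) : ℝ) ≤ coverNum F r₀ := by
      exact_mod_cast hF.coverNum_le_coverNum hr₀pos (by linarith)
        (Real.rpow_le_rpow hR₀'.le hge (by positivity)) x
    have h2 : 1 ≤ (R / R ^ (1 / θ)) ^ α :=
      Real.one_le_rpow ((one_le_div hpow).2 hle) hα0
    have h3 : (0 : ℝ) ≤ coverNum F r₀ := Nat.cast_nonneg _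
    have h4 : (0 : ℝ) ≤ (4 * T.H + 2) ^ 2 := by positivity
    nlinarith

/-- A logarithmic bound for the counts passes to the limit. -/
theorem le_of_log_le {f : ℝ → ℝ} {s c α : ℝ}
    (hs : Tendsto (fun R : ℝ => f R / Real.log (1 / R)) (𝓝[>] 0) (𝓝 s))
    (h : ∀ R, 0 < R → R < 1 → f R ≤ c + α * Real.log (1 / R)) : s ≤ α := by
  have h1 : Tendsto (fun R : ℝ => c / Real.log (1 / R) + α) (𝓝[>] 0) (𝓝 α) := by
    simpa using (tendsto_log_one_div.const_div_atTop c).add_const α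
  refine le_of_tendsto_of_tendsto hs h1 ?_
  filter_upwards [tendsto_log_one_div.eventually_gt_atTop 0,
    Ioo_mem_nhdsGT (zero_lt_one (α := ℝ))] with R hL hR
  rw [div_le_iff₀ hL, add_mul, div_mul_cancel₀ _ hL.ne']
  exact h R hR.1 hR.2

/-- Positivity of `c` is forced by `0 < x`, which matters since the definition of `upperBoxDim` does
not require a positive constant. -/
theorem log_le_add_of_le_mul {x y c α : ℝ} (hx : 0 < x) (hy : 0 < y) (h : x ≤ c * y ^ α) :
    Real.log x ≤ Real.log c + α * Real.log y := by
  have hy' := Real.rpow_pos_of_pos hy α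
  have hc : 0 < c := pos_of_mul_pos_left (hx.trans_le h) hy'.le
  rw [← Real.log_rpow hy, ← Real.log_mul hc.ne' hy'.ne']
  exact Real.log_le_log hx h

theorem Codes.le_of_bound (hF : T.Codes F) {θ s α C : ℝ} (hθ : 0 < θ) (hθ1 : θ < 1)
    (hs : Tendsto (fun R : ℝ => Real.log (T.count R (R ^ (1 / θ))) / Real.log (1 / R)) (𝓝[>] 0)
      (𝓝 s))
    (hC : ∀ R : ℝ, 0 < R → R < 1 → ∀ x ∈ F,
      (coverNum (Metric.closedBall x R ∩ F) (R ^ (1 / θ)) : ℝ) ≤ C * (R / R ^ (1 / θ)) ^ α) :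
    s ≤ α * (1 / θ - 1) := by
  refine le_of_log_le (c := Real.log ((4 * T.H + 2) ^ 2 * C)) hs fun R hR hR1 => ?_
  have hpow : 0 < R ^ (1 / θ) := Real.rpow_pos_of_pos hR _
  obtain ⟨x, hx, hxc⟩ := hF.exists_le_coverNum hpow (rpow_one_div_le hθ hθ1 hR hR1.le)
    (by linarith)
  rw [mul_assoc, ← log_div_rpow hR]
  refine log_le_add_of_le_mul (count_cast_pos _ _) (by positivity) ?_
  have hxc' : (T.count R (R ^ (1 / θ)) : ℝ) ≤
      (4 * T.H + 2) ^ 2 * coverNum (Metric.closedBall x R ∩ F) (R ^ (1 / θ)) := by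
    exact_mod_cast hxc
  refine hxc'.trans ?_
  rw [mul_assoc]
  gcongr
  exact hC R hR hR1 x hx

theorem sInf_eq_of_threshold {A : Set ℝ} {s : ℝ} (h1 : ∀ α, s < α → α ∈ A)
    (h2 : ∀ α ∈ A, s ≤ α) : sInf A = s :=
  csInf_eq_of_forall_ge_of_forall_gt_exists_lt ⟨s + 1, h1 _ (by linarith)⟩ h2 fun w hw =>
    ⟨(s + w) / 2, h1 _ (by linarith), by linarith⟩

theorem Codes.assouadSpectrum_eq (hF : T.Codes F) {θ s : ℝ} (hθ : 0 < θ) (hθ1 : θ < 1)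
    (hs : Tendsto (fun R : ℝ => Real.log (T.count R (R ^ (1 / θ))) / Real.log (1 / R)) (𝓝[>] 0)
      (𝓝 s)) : assouadSpectrum F θ = s / (1 / θ - 1) := by
  have hθ' : 0 < 1 / θ - 1 := by have := one_lt_one_div hθ hθ1; linarith
  refine sInf_eq_of_threshold (fun α hα => ?_) ?_
  · exact hF.exists_bound_of_lt hθ hθ1 hs ((div_lt_iff₀ hθ').1 hα)
  · rintro α ⟨C, -, hC⟩
    exact (div_le_iff₀ hθ').2 (hF.le_of_bound hθ hθ1 hs hC)

theorem Codes.upperBoxDim_eq (hF : T.Codes F) {s : ℝ}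
    (hs : Tendsto (fun r : ℝ => Real.log (T.count 2 r) / Real.log (1 / r)) (𝓝[>] 0) (𝓝 s)) :
    upperBoxDim F = s := by
  obtain ⟨y, hy⟩ := hF.nonempty
  have hFy := hF.closedBall_two_inter hy
  refine sInf_eq_of_threshold (fun α hα => ?_) ?_
  · have hs0 : 0 ≤ s := limit_nonneg hs
    obtain ⟨r₀, hr₀, hsub⟩ := mem_nhdsGT_iff_exists_Ioo_subset.1
      ((hs.eventually_lt_const hα).and (tendsto_log_one_div.eventually_gt_atTop 0))
    have hr₀' : (0 : ℝ) < min r₀ 1 := lt_min hr₀ one_pos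
    refine ⟨(4 * T.H + 2) ^ 2 + coverNum F (min r₀ 1), fun r hr hr1 => ?_⟩
    rcases lt_or_ge r (min r₀ 1) with hlt | hge
    · have h1 := hsub ⟨hr, hlt.trans_le (min_le_left _ _)⟩
      have h2 : (T.count 2 r : ℝ) ≤ (1 / r) ^ α :=
        le_rpow_of_log_le (count_cast_pos _ _) (by positivity) ((div_lt_iff₀ h1.2).1 h1.1).le
      have h3 : (coverNum F r : ℝ) ≤ T.count 2 r * (4 * T.H + 2) ^ 2 := by
        have := (hF.coverNum_le hr (by linarith : r ≤ 2) le_rfl y).1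
        rw [hFy] at this
        exact_mod_cast this
      calc _ ≤ _ := h3
        _ ≤ (1 / r) ^ α * (4 * T.H + 2) ^ 2 := by gcongr
        _ ≤ _ := by
          rw [mul_comm]
          gcongr
          simp
    · have h1 : (coverNum F r : ℝ) ≤ coverNum F (min r₀ 1) := by
        have := hF.coverNum_le_coverNum (R := 2) hr₀' ((min_le_right _ _).trans one_le_two) hge y
        rw [hFy] at this
        exact_mod_cast this
      have h2 : 1 ≤ (1 / r) ^ α :=
        Real.one_le_rpow ((one_le_div hr).2 hr1.le) (by linarith)
      have h3 : (0 : ℝ) ≤ coverNum F (min r₀ 1) := Nat.cast_nonneg _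
      have h4 : (0 : ℝ) ≤ (4 * T.H + 2) ^ 2 := by positivity
      nlinarith
  · rintro α ⟨C, hC⟩
    refine le_of_log_le (c := Real.log ((4 * T.H + 2) ^ 2 * C)) hs fun r hr hr1 => ?_
    obtain ⟨x, hx, hxc⟩ := hF.exists_le_coverNum hr (by linarith : r ≤ 2) le_rfl
    rw [hF.closedBall_two_inter hx] at hxc
    refine log_le_add_of_le_mul (count_cast_pos _ _) (by positivity) ?_
    have hxc' : (T.count 2 r : ℝ) ≤ (4 * T.H + 2) ^ 2 * coverNum F r := by exact_mod_cast hxc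
    refine hxc'.trans ?_
    rw [mul_assoc]
    gcongr
    exact hC r hr hr1

theorem Codes.exists_upper_bound_of_lt (hF : T.Codes F) (h : T.HasAverages a b γ η β) {θ α : ℝ}
    (hθ : 0 < θ) (hθ1 : θ < 1) (hα : γ / b + β / a < α) :
    ∃ C : ℝ, 0 < C ∧ ∀ r R : ℝ, 0 < r → r ≤ R ^ (1 / θ) → R ^ (1 / θ) ≤ R →
      0 < R → R < 1 → ∀ x ∈ F,
        (coverNum (Metric.closedBall x R ∩ F) r : ℝ) ≤ C * (R / r) ^ α := by
  -- Two sums at two scales give total error `2 * ε * (log (1/r) + log (1/R))`. As `log (1/R) ≤ θ *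
  -- log (1/r)`, this `ε` fits it into the slack in `α` times `log (R / r)`.
  set ε := (α - (γ / b + β / a)) * (1 - θ) / 4 with hε
  have hεpos : 0 < ε := by
    have := sub_pos.2 hα
    have := sub_pos.2 hθ1
    positivity
  obtain ⟨K, hK⟩ := exists_abs_sub_le (fun r => logSum_nonneg T.colMaxSeq (T.rowLevel r))
    (fun r R hr hrR => logSum_mono _ (T.rowLevel_anti hr hrR))
    (h.tendsto_rowLevel h.colMax) hεpos
  obtain ⟨K', hK'⟩ := exists_abs_sub_le (fun r => logSum_nonneg T.colNumSeq (T.colLevel r))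
    (fun r R hr hrR => logSum_mono _ (T.colLevel_anti hr hrR))
    (h.tendsto_colLevel h.colNum) hεpos
  refine ⟨Real.exp (2 * K + 2 * K') * (4 * T.H + 2) ^ 2, by positivity,
    fun r R hr hrθ hRθ hR hR1 x _ => ?_⟩
  have hrR := hrθ.trans hRθ
  have h1 : (coverNum (Metric.closedBall x R ∩ F) r : ℝ) ≤
      T.count R r * (4 * T.H + 2) ^ 2 := by
    exact_mod_cast (hF.coverNum_le hr hrR (by linarith) x).1
  have h2 : (T.count R r : ℝ) ≤ Real.exp (2 * K + 2 * K') * (R / r) ^ α := by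
    rw [← Real.log_le_log_iff (count_cast_pos _ _) (by positivity),
      Real.log_mul (by positivity) (by positivity), Real.log_exp, Real.log_rpow (by positivity)]
    have hdiv : Real.log (R / r) = Real.log (1 / r) - Real.log (1 / R) := by
      rw [Real.log_div hR.ne' hr.ne', one_div, one_div, Real.log_inv, Real.log_inv]
      ring
    have hLR : 0 ≤ Real.log (1 / R) := Real.log_nonneg ((one_le_div hR).2 hR1.le)
    have hLθ : Real.log (1 / R) ≤ θ * Real.log (1 / r) := by
      have h3 := Real.log_le_log (by positivity) (one_div_le_one_div_of_le hr hrθ)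
      rwa [log_one_div_rpow hR, div_le_iff₀ hθ, mul_comm] at h3
    have e1 := abs_le.1 (hK r hr (hrR.trans_lt hR1))
    have e2 := abs_le.1 (hK R hR hR1)
    have e3 := abs_le.1 (hK' r hr (hrR.trans_lt hR1))
    have e4 := abs_le.1 (hK' R hR hR1)
    have e5 := T.log_count_le hr hrR
    have e6 : 2 * ε * (Real.log (1 / r) + Real.log (1 / R)) ≤
        (α - (γ / b + β / a)) * Real.log (R / r) := by
      rw [hdiv, hε]
      have := sub_pos.2 hα
      have h4 : 0 ≤ (α - (γ / b + β / a)) * (θ * Real.log (1 / r) - Real.log (1 / R)) :=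
        mul_nonneg this.le (by linarith)
      have h5 : 0 ≤ (α - (γ / b + β / a)) * ((1 - θ) * (Real.log (1 / r) - Real.log (1 / R))) := by
        refine mul_nonneg this.le (mul_nonneg (by linarith) ?_)
        nlinarith
      nlinarith
    rw [hdiv] at e6 ⊢
    linarith [e1.2, e2.1, e3.2, e4.1]
  calc _ ≤ _ := h1
    _ ≤ Real.exp (2 * K + 2 * K') * (R / r) ^ α * (4 * T.H + 2) ^ 2 := by gcongr
    _ = _ := by ring

/-- For θ ≥ a/b no level contributes its full digit number asymptotically, so η drops out, and the
factor 1/θ - 1 cancels. -/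
theorem spectrum_formula_of_le {a b γ η β θ : ℝ} (ha : 0 < a) (hb : 0 < b) (hγ : 0 ≤ γ)
    (hη : 0 ≤ η) (hβ : 0 ≤ β) (hθ : 0 < θ) (hθ1 : θ < 1) (hab : a ≤ θ * b) :
    ((min (γ / a) (γ / b / θ) - γ / b) + (max (η / a) (η / b / θ) - η / a) +
        (β / a / θ - max (β / a) (β / b / θ))) / (1 / θ - 1) = γ / b + β / a := by
  have h1θ : 0 < 1 - θ := by linarith
  have hθ' : 1 / θ - 1 = (1 - θ) / θ := by field_simp
  have key : ∀ x : ℝ, 0 ≤ x → x / b / θ ≤ x / a := fun x hx => by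
    rw [div_div, mul_comm]
    gcongr
  rw [min_eq_right (key γ hγ), max_eq_left (key η hη), max_eq_left (key β hβ), hθ']
  field_simp
  ring

/-- The value of the Assouad spectrum in terms of the averages. -/
theorem spectrum_formula {a b γ η β θ : ℝ} (ha : 0 < a) (hb : 0 < b) (hγ : 0 ≤ γ) (hη : 0 ≤ η)
    (hβ : 0 ≤ β) (hle : η ≤ γ + β) (hθ : 0 < θ) (hθ1 : θ < 1) :
    ((min (γ / a) (γ / b / θ) - γ / b) + (max (η / a) (η / b / θ) - η / a) +
        (β / a / θ - max (β / a) (β / b / θ))) / (1 / θ - 1) =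
      min (((η / b + (β / a - β / b)) - θ * ((γ / b + β / a) -
        ((γ / b + β / a) - (η / b + (β / a - β / b))) * (b / a))) / (1 - θ)) (γ / b + β / a) := by
  have h1θ : 0 < 1 - θ := by linarith
  have hθ' : 1 / θ - 1 = (1 - θ) / θ := by field_simp
  have hd := sub_nonneg.2 hle
  rcases le_total (θ * b) a with hab | hab
  · have key : ∀ x : ℝ, 0 ≤ x → x / a ≤ x / b / θ := fun x hx => by
      rw [div_div, mul_comm]
      gcongr
    rw [min_eq_left (key γ hγ), max_eq_right (key η hη), max_eq_right (key β hβ), min_eq_left, hθ']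
    · field_simp
      ring
    · rw [div_le_iff₀ h1θ, ← sub_nonneg]
      -- The sign of the difference between the terms of the minimum is read off from the factors γ
      -- + β - η and a - θb.
      have : (γ / b + β / a) * (1 - θ) - ((η / b + (β / a - β / b)) - θ * ((γ / b + β / a) -
        ((γ / b + β / a) - (η / b + (β / a - β / b))) * (b / a))) =
          (γ + β - η) * (a - θ * b) / (a * b) := by
        field_simp
        ring
      rw [this]
      have := sub_nonneg.2 hab
      positivity
  · rw [spectrum_formula_of_le ha hb hγ hη hβ hθ hθ1 hab, min_eq_right]
    rw [le_div_iff₀ h1θ, ← sub_nonneg]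
    have : ((η / b + (β / a - β / b)) - θ * ((γ / b + β / a) -
      ((γ / b + β / a) - (η / b + (β / a - β / b))) * (b / a))) - (γ / b + β / a) * (1 - θ) =
        (γ + β - η) * (θ * b - a) / (a * b) := by
      field_simp
      ring
    rw [this]
    have := sub_nonneg.2 hab
    positivity

/-- The function is constant on (a/b, 1), an interval that is non-empty because a < b. The lower
bound already comes from the single scale `r = R ^ (1 / θ)`. -/
theorem Codes.tendsto_upperAssouadSpectrum (hF : T.Codes F) (h : T.HasAverages a b γ η β) :
    Tendsto (upperAssouadSpectrum F) (𝓝[<] (1 : ℝ)) (𝓝 (γ / b + β / a)) := by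
  have hab : a / b < 1 := (div_lt_one h.n_pos).2 h.m_lt_n
  refine tendsto_const_nhds.congr' ?_
  filter_upwards [Ioo_mem_nhdsLT hab] with θ hθ
  have hθ0 : 0 < θ := (div_pos h.m_pos h.n_pos).trans hθ.1
  have hθ' : 0 < 1 / θ - 1 := by have := one_lt_one_div hθ0 hθ.2; linarith
  symm
  refine sInf_eq_of_threshold (fun α hα => hF.exists_upper_bound_of_lt h hθ0 hθ.2 hα) ?_
  rintro α ⟨C, -, hC⟩
  rw [← spectrum_formula_of_le h.m_pos h.n_pos h.colMax_nonneg h.card_nonneg h.colNum_nonneg hθ0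
    hθ.2 ((div_le_iff₀ h.n_pos).1 hθ.1.le), div_le_iff₀ hθ']
  refine hF.le_of_bound (C := C) hθ0 hθ.2 (h.tendsto_log_count hθ0 hθ.2) fun R hR hR1 x hx => ?_
  exact hC _ R (Real.rpow_pos_of_pos hR _) le_rfl (rpow_one_div_le hθ0 hθ.2 hR hR1.le) hR hR1 x hx

/-- The Assouad spectrum in terms of the box dimension and the quasi-Assouad dimension. -/
theorem Codes.assouadSpectrum_formula (hF : T.Codes F) (h : T.HasAverages a b γ η β) {θ : ℝ}
    (hθ : 0 < θ) (hθ1 : θ < 1) :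
    assouadSpectrum F θ = min ((upperBoxDim F - θ * (quasiAssouadDim F -
      (quasiAssouadDim F - upperBoxDim F) * (b / a))) / (1 - θ)) (quasiAssouadDim F) := by
  rw [hF.assouadSpectrum_eq hθ hθ1 (h.tendsto_log_count hθ hθ1),
    hF.upperBoxDim_eq h.tendsto_log_count_two, quasiAssouadDim,
    (hF.tendsto_upperAssouadSpectrum h).limUnder_eq]
  exact spectrum_formula h.m_pos h.n_pos h.colMax_nonneg h.card_nonneg h.colNum_nonneg h.card_le
    hθ hθ1

end DigitSeq

/-! ### Almost sure averages -/

section Bernoulli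

variable {Λ : Type*} [Fintype Λ] [MeasurableSpace Λ] [MeasurableSingletonClass Λ]

theorem integral_letterMeasure {p : Λ → ℝ} (hp : ∀ i, 0 ≤ p i) (f : Λ → ℝ) :
    ∫ i, f i ∂(letterMeasure p) = ∑ i, p i * f i := by
  rw [letterMeasure, integral_finsetSum_measure fun i _ =>
    (integrable_dirac (by simp)).smul_measure ENNReal.ofReal_ne_top]
  refine Finset.sum_congr rfl fun i _ => ?_
  rw [integral_smul_measure, integral_dirac, ENNReal.toReal_ofReal (hp i), smul_eq_mul]

/-- The strong law of large numbers for functions of the letters. -/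
theorem ae_tendsto_average {p : Λ → ℝ} (hp : ∀ i, 0 ≤ p i) (hsum : ∑ i, p i = 1) (f : Λ → ℝ) :
    ∀ᵐ ω ∂(bernoulli p), Tendsto (fun k : ℕ => (∑ l ∈ Finset.range k, f (ω l)) / k) atTop
      (𝓝 (∑ i, p i * f i)) := by
  have := isProbabilityMeasure_letterMeasure p hp hsum
  have hf : Measurable f := measurable_of_countable f
  have hmap : ∀ l, Measure.map (fun ω : ℕ → Λ => ω l) (bernoulli p) = letterMeasure p :=
    fun l => Measure.infinitePi_map_eval _ l
  have hint : Integrable f (letterMeasure p) := Integrable.of_finite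
  have hmean : ∀ l, ∫ ω, f (ω l) ∂(bernoulli p) = ∑ i, p i * f i := fun l => by
    rw [← integral_letterMeasure hp, ← hmap l,
      integral_map (measurable_pi_apply l).aemeasurable hf.aestronglyMeasurable]
  have hindep : ProbabilityTheory.iIndepFun (fun (l : ℕ) (ω : ℕ → Λ) => f (ω l))
      (bernoulli p) := ProbabilityTheory.iIndepFun_infinitePi fun _ => hf
  have hlln := ProbabilityTheory.strong_law_ae_real (fun (l : ℕ) (ω : ℕ → Λ) => f (ω l))
    (μ := bernoulli p) ?_ (fun l l' h => hindep.indepFun h) fun l => ?_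
  · rwa [hmean 0] at hlln
  · rw [← hmap 0] at hint
    exact hint.comp_measurable (measurable_pi_apply 0)
  · refine ⟨(hf.comp (measurable_pi_apply l)).aemeasurable,
      (hf.comp (measurable_pi_apply 0)).aemeasurable, ?_⟩
    rw [← Function.comp_def f, ← Function.comp_def f, ← Measure.map_map hf (measurable_pi_apply l),
      ← Measure.map_map hf (measurable_pi_apply 0)]
    exact congrArg _ ((hmap l).trans (hmap 0).symm)

theorem ae_hasAverages (S : Patterns Λ) {p : Λ → ℝ} (hp : ∀ i, 0 < p i) (hsum : ∑ i, p i = 1) :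
    ∀ᵐ ω ∂(bernoulli p), (S.digitSeq ω).HasAverages
      (∑ i, p i * Real.log (S.m i)) (∑ i, p i * Real.log (S.n i))
      (∑ i, p i * Real.log (colMax (S.digits i))) (∑ i, p i * Real.log (S.digits i).card)
      (∑ i, p i * Real.log (colNum (S.digits i))) := by
  -- The weights sum to 1, so there is a letter; this makes a > 0 and a < b strict.
  have hne : (Finset.univ : Finset Λ).Nonempty := by
    by_contra h
    rw [Finset.not_nonempty_iff_eq_empty] at h
    simp [h] at hsum
  have hnonneg : ∀ X : Λ → ℕ, 0 ≤ ∑ i, p i * Real.log (X i) := fun X =>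
    Finset.sum_nonneg fun i _ => mul_nonneg (hp i).le (Real.log_natCast_nonneg _)
  have hp' : ∀ i, 0 ≤ p i := fun i => (hp i).le
  filter_upwards [ae_tendsto_average hp' hsum fun i => Real.log (S.m i),
    ae_tendsto_average hp' hsum fun i => Real.log (S.n i),
    ae_tendsto_average hp' hsum fun i => Real.log (colMax (S.digits i)),
    ae_tendsto_average hp' hsum fun i => Real.log (S.digits i).card,
    ae_tendsto_average hp' hsum fun i => Real.log (colNum (S.digits i))] with ω h1 h2 h3 h4 h5
  refine ⟨h1, h2, h3, h4, h5, ?_, ?_, hnonneg _, hnonneg _, hnonneg _, ?_⟩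
  · refine Finset.sum_pos (fun i _ => mul_pos (hp i) (Real.log_pos ?_)) hne
    exact_mod_cast S.two_le_m i
  · refine Finset.sum_lt_sum_of_nonempty hne fun i _ => ?_
    have := S.two_le_m i
    exact mul_lt_mul_of_pos_left (Real.log_lt_log (by positivity)
      (by exact_mod_cast S.m_lt_n i)) (hp i)
  · rw [← Finset.sum_add_distrib]
    refine Finset.sum_le_sum fun i _ => ?_
    have h1 := colMax_pos (S.digits_nonempty i)
    have h2 := colNum_pos (S.digits_nonempty i)
    have h3 := Finset.card_pos.2 (S.digits_nonempty i)
    rw [← mul_add, ← Real.log_mul (by positivity) (by positivity)]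
    exact mul_le_mul_of_nonneg_left (Real.log_le_log (by positivity)
      (by exact_mod_cast card_le_colNum_mul_colMax (S.digits i))) (hp i).le

end Bernoulli

end RandomCarpet

end

/-! ### The almost sure formula -/

theorem corollary3 {Λ : Type*} [Fintype Λ] [MeasurableSpace Λ] [MeasurableSingletonClass Λ]
    (S : RandomCarpet.Patterns Λ) (p : Λ → ℝ) (hp : ∀ i, 0 < p i) (hsum : ∑ i, p i = 1) :
    ∀ᵐ ω ∂(RandomCarpet.bernoulli p),
      Tendsto (RandomCarpet.upperAssouadSpectrum (S.carpet ω)) (𝓝[<] (1 : ℝ))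
        (𝓝 (RandomCarpet.quasiAssouadDim (S.carpet ω))) ∧
      ∀ θ : ℝ, 0 < θ → θ < 1 →
        RandomCarpet.assouadSpectrum (S.carpet ω) θ =
          min
            ((RandomCarpet.upperBoxDim (S.carpet ω) -
                θ * (RandomCarpet.quasiAssouadDim (S.carpet ω) -
                  (RandomCarpet.quasiAssouadDim (S.carpet ω) -
                    RandomCarpet.upperBoxDim (S.carpet ω)) *
                  ((∑ i, p i * Real.log (S.n i)) / (∑ i, p i * Real.log (S.m i))))) / (1 - θ))
            (RandomCarpet.quasiAssouadDim (S.carpet ω)) := by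
  filter_upwards [RandomCarpet.ae_hasAverages S hp hsum] with ω h
  have hF := S.codes_carpet ω
  have hq := hF.tendsto_upperAssouadSpectrum h
  refine ⟨?_, fun θ hθ hθ1 => hF.assouadSpectrum_formula h hθ hθ1⟩
  rw [RandomCarpet.quasiAssouadDim, hq.limUnder_eq]
  exact hq
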